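/- **Theorem 1.** Let $(u_i,\mathbf x_i,c_i)$, $i=1,2,\dots$, be i.i.d. random elements of $\mathbb R\times\mathbb R^p\times\mathbb R$ such that $u_i$ is independent of $(\mathbf x_i,c_i)$. For a fixed $\beta_0\in\mathbb R^p$ let $y_i=\beta_0'\mathbf x_i+u_i$, and observe $(y_i^*,\mathbf x_i,\delta_i)$, where $y_i^*=\min(y_i,c_i)$ and $\delta_i=I\{y_i\le c_i\}$. Let $F$ be the distribution function of the errors $u_i$, let $G(\mathbf v)=P(\mathbf x_1\le\mathbf v)$ (coordinatewise order) be that of the covariates, and let $D$ be the distribution function of the variables $c_i-\beta_0'\mathbf x_i$, which censor the errors. Put $\tau_F=\inf\{t:F(t)=1\}$, $\tau_D=\inf\{t:D(t)=1\}$ (with $\inf\emptyset=\infty$), and assume: R1. $\tau_F<\tau_D$, or $\tau_F=\tau_D=\infty$, or $\tau_F=\tau_D<\infty$ and $\tau_F$ is a continuity point of $F$. R2. $F$ and $D$ have no jumps in common. For $n\ge1$ let $r_i^*=y_i^*-\beta_0'\mathbf x_i$, $1\le i\le n$, and let $\pi_j$ be the mass that the Kaplan–Meier (product-limit) estimator based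 on $(r_i^*,\delta_i)_{1\le i\le n}$ gives to the $j$-th observation: with $Y(s)=\#\{k\le n:r_k^*\ge s\}$ and $d(s)=\#\{k\le n:\delta_k=1,\ r_k^*=s\}$, $\pi_j=\frac1{Y(r_j^*)}\prod_{s<r_j^*,\,d(s)>0}\bigl(1-\frac{d(s)}{Y(s)}\bigr)$ if $\delta_j=1$, and $\pi_j=0$ if $\delta_j=0$. Let $M_i=\{j\le n:r_j^*>r_i^*,\ \delta_j=1\}$ and $$\pi_{ij}=\begin{cases}\dfrac1n\,\dfrac{\pi_j}{\sum_{k\in M_i}\pi_k},&\delta_i=0,\ j\in M_i,\\[2mm] \dfrac1n,&\delta_i=1,\ i=j,\\[1mm] 0,&\text{otherwise.}\end{cases}$$ Let $H^*_{n\beta_0}$ be the distribution function of the discrete distribution that assigns mass $\pi_{ij}$ to the point $(r_j^*,\mathbf x_i)$, $1\le i,j\le n$, that is, $H^*_{n\beta_0}(a,\mathbf v)=\sum_{i=1}^n\sum_{j=1}^n\pi_{ij}\,I\{r_j^*\le a,\ \mathbf x_i\le\mathbf v\}$. Then, almost surely, $H^*_{n\beta_0}(a,\mathbf v)\to H(a,\mathbf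 v)=F(a)G(\mathbf v)$ as $n\to\infty$ for all $a\in\mathbb R$ and $\mathbf v\in\mathbb R^p$. -/

import Mathlib

open MeasureTheory ProbabilityTheory Filter Topology

noncomputable section

namespace CensoredRegression

section KaplanMeier

/-! Right-censored samples `(r j, δ j)`, `j < n`. Here `r j` is the recorded value, and `δ j` says
that the `j`-th value is uncensored. -/

open Classical in
/-- The number `#{k < n : t ≤ r k}` of observations at risk at `t`. -/
def atRisk (n : ℕ) (r : ℕ → ℝ) (t : ℝ) : ℕ :=
  ((Finset.range n).filter fun k => t ≤ r k).card

open Classical in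
/-- The number `#{k < n : δ k, r k = t}` of uncensored observations at `t`. -/
def deaths (n : ℕ) (r : ℕ → ℝ) (δ : ℕ → Prop) (t : ℝ) : ℕ :=
  ((Finset.range n).filter fun k => δ k ∧ r k = t).card

open Classical in
/-- The left limit at `t` of the product-limit (Kaplan–Meier) estimator of the survival function:
the product of `1 - d(s) / Y(s)` over the distinct uncensored values `s < t`, where `d(s)` is the
number of uncensored observations at `s` and `Y(s)` the number at risk at `s`. -/
def kmSurvivalLeft (n : ℕ) (r : ℕ → ℝ) (δ : ℕ → Prop) (t : ℝ) : ℝ :=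
  ∏ s ∈ (((Finset.range n).filter fun k => δ k).image r).filter (fun s => s < t),
    (1 - (deaths n r δ s : ℝ) / (atRisk n r s : ℝ))

open Classical in
/-- The probability `π j` that the Kaplan–Meier estimator gives to the `j`-th observation. At an
uncensored value `t` the estimator jumps by `S(t-) * d(t) / Y(t)`, shared equally by the `d(t)`
uncensored observations at `t`; censored observations get nothing. -/
def kmWeight (n : ℕ) (r : ℕ → ℝ) (δ : ℕ → Prop) (j : ℕ) : ℝ :=
  if δ j then kmSurvivalLeft n r δ (r j) / (atRisk n r (r j) : ℝ) else 0

open Classical in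
/-- The set `M i = {j < n : r i < r j, δ j}` of uncensored observations to the right of the
`i`-th one. -/
def uncensoredRight (n : ℕ) (r : ℕ → ℝ) (δ : ℕ → Prop) (i : ℕ) : Finset ℕ :=
  (Finset.range n).filter fun j => r i < r j ∧ δ j

open Classical in
/-- The part `π i j` of the mass `1 / n` of the `i`-th observation that goes to the `j`-th one. An
uncensored observation keeps its mass; the mass of a censored one is distributed among the
uncensored observations to its right, proportionally to their Kaplan–Meier weights (all `π i j`
are zero for a censored observation with no uncensored one to its right). -/
def redistributedMass (n : ℕ) (r : ℕ → ℝ) (δ : ℕ → Prop) (i j : ℕ) : ℝ :=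
  if δ i then (if i = j then 1 / (n : ℝ) else 0)
  else if j ∈ uncensoredRight n r δ i then
    1 / (n : ℝ) * (kmWeight n r δ j / ∑ k ∈ uncensoredRight n r δ i, kmWeight n r δ k)
  else 0

open Classical in
/-- The distribution function at `(a, v)` of the discrete distribution that gives mass `π i j` to
the point `(r j, x i)`, for `i, j < n`; the order on `Fin p → ℝ` is the coordinatewise one. -/
def redistributedDistribution {p : ℕ} (n : ℕ) (r : ℕ → ℝ) (δ : ℕ → Prop) (x : ℕ → Fin p → ℝ)
    (a : ℝ) (v : Fin p → ℝ) : ℝ :=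
  ∑ i ∈ Finset.range n, ∑ j ∈ Finset.range n,
    if r j ≤ a ∧ x i ≤ v then redistributedMass n r δ i j else 0

end KaplanMeier

section Model

variable {Ω : Type*} [MeasurableSpace Ω] {p : ℕ}

/-- The censored linear regression model: `y i = β₀' x i + u i`, the triples `(u i, x i, c i)` of
errors, covariates and censoring variables are i.i.d., and the errors are independent of the
covariates and the censoring variables. Covariates and censoring variables may depend on each
other. -/
structure IsCensoredLinearModel (P : Measure Ω) (β₀ : Fin p → ℝ) (u : ℕ → Ω → ℝ)
    (x : ℕ → Ω → Fin p → ℝ) (c y : ℕ → Ω → ℝ) : Prop where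
  measurable_error : ∀ i, Measurable (u i)
  measurable_covariate : ∀ i, Measurable (x i)
  measurable_censoring : ∀ i, Measurable (c i)
  response_eq : ∀ i ω, y i ω = β₀ ⬝ᵥ x i ω + u i ω
  iIndepFun_sample : iIndepFun (fun i ω => (u i ω, x i ω, c i ω)) P
  identDistrib_sample : ∀ i, IdentDistrib (fun ω => (u i ω, x i ω, c i ω))
    (fun ω => (u 0 ω, x 0 ω, c 0 ω)) P P
  indepFun_error : ∀ i, IndepFun (u i) (fun ω => (x i ω, c i ω)) P

/-- The observed response `y* = min y c`. -/
def observedResponse (c y : ℕ → Ω → ℝ) (ω : Ω) (i : ℕ) : ℝ := min (y i ω) (c i ω)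

/-- The event `y ≤ c` that the response is not censored. -/
def uncensored (c y : ℕ → Ω → ℝ) (ω : Ω) (i : ℕ) : Prop := y i ω ≤ c i ω

/-- The censored residual `y* - β' x`. -/
def censoredResidual (x : ℕ → Ω → Fin p → ℝ) (c y : ℕ → Ω → ℝ) (β : Fin p → ℝ) (ω : Ω)
    (i : ℕ) : ℝ :=
  observedResponse c y ω i - β ⬝ᵥ x i ω

/-- The distribution function `H*` built from the first `n` observations `(y*, x, δ)` and the
parameter `β`. -/
def Hstar (x : ℕ → Ω → Fin p → ℝ) (c y : ℕ → Ω → ℝ) (β : Fin p → ℝ) (n : ℕ) (ω : Ω)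
    (a : ℝ) (v : Fin p → ℝ) : ℝ :=
  redistributedDistribution n (censoredResidual x c y β ω) (uncensored c y ω)
    (fun i => x i ω) a v

end Model

/-- The upper end point `inf {t : F t = 1}` of a distribution function, which is `⊤` if `F` never
takes the value `1`. -/
def upperEndpoint (F : ℝ → ℝ) : EReal := sInf ((fun t : ℝ => (t : EReal)) '' {t | F t = 1})

/-- `τ_F < τ_D`, or `τ_F = τ_D = ∞`, or `τ_F = τ_D` is a (finite) continuity point of `F`. -/
def ConditionR1 (F D : ℝ → ℝ) : Prop :=
  upperEndpoint F < upperEndpoint D ∨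
    (upperEndpoint F = ⊤ ∧ upperEndpoint D = ⊤) ∨
    ∃ t : ℝ, upperEndpoint F = (t : EReal) ∧ upperEndpoint D = (t : EReal) ∧ ContinuousAt F t

/-- `F` and `D` have no jump in common. -/
def ConditionR2 (F D : ℝ → ℝ) : Prop := ∀ t : ℝ, ContinuousAt F t ∨ ContinuousAt D t

end CensoredRegression

end

/-!
Write `T = u`, `C = c - β₀' x`, `r = min T C`, `δ = (T ≤ C)`, let `S` and `K` be the survival
functions of `T` and `C`, and `Ŝ` the Kaplan–Meier estimator of `S`. The Kaplan–Meier mass of an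
interval is a difference of values of `Ŝ`, so a censored observation at `r` puts the proportion
`(Ŝ(r) - Ŝ(a)) / (Ŝ(r) - Ŝ(∞))` of its mass on `Iic a`. If `Ŝ → S` and `Ŝ(∞) → 0`, this tends to
`1 - S(a) / S(r)`, the conditional probability of `T ≤ a` given `T > r`. So the mass at `(a, v)`
tends to `P(T ≤ a, x ≤ v) = F(a) G(v)`.

All limits come from the strong law of large numbers for finitely many events at a time, by cutting
`Iic a` into finitely many cells, along a chain of half-lines starting with the empty set.

* On a cell, the Kaplan–Meier product lies between the two telescoping products that arise when all
  censorings of the cell are moved to its end or to its beginning (`kmProd_le_mul`,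
  `mul_le_kmProd`). The limits of these bounds enclose the increment of `S`, and differ by at most a
  constant times `P(T ∈ cell) P(C ∈ cell)` (`cell_bounds`).
* Likewise, moving the censored observations of a cell to either end of it bounds the redistributed
  mass, again up to `P(T ∈ cell) P(C ∈ cell)` in the limit (`massFreq_bounds`, `cell_gap`).
* The sum of these products over the cells is the measure of a neighbourhood of the diagonal under
  the product of the laws of `T` and `C`. The diagonal is a null set exactly because the two laws
  have no common atom, so the sum is small for a fine chain (`exists_isLowerChain`).

This gives `Ŝ(t) → S(t)` where `S(t) K(t) > 0` (`IsRandomCensorship.ae_tendsto_kmProd`), and the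
theorem for `F(a) < 1` (`IsRandomCensorship.ae_tendsto_massFreq_of_lt`) once `Ŝ(∞) → 0` is known.
The condition on the end points leaves two cases (`ConditionR1.exhaust_or_atom`). Either `F(b)` is
arbitrarily close to one for points `b` with `F(b) < 1`, and then `Ŝ(∞) ≤ Ŝ(b)`, and the
monotonicity in `a` settles `F(a) = 1`. Or the end point `τ` of `F` is an atom of `F` with
`K(τ) > 0`; then from some `n` on the largest observation is an uncensored one at `τ`, so `Ŝ`
vanishes from `τ` on, and all mass is redistributed to `Iic τ`.

Finally, the distribution functions are monotone in `(a, v)`, and countably many points bracket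
every `(a, v)` up to an arbitrarily small difference of the limits, so that the exceptional null
set can be chosen independently of `(a, v)`.
-/

noncomputable section

namespace CensoredRegression

/-! ### Telescoping bounds for products -/

theorem filter_lt_insert_eq {s : ℝ} {B : Finset ℝ} (hs : ∀ t ∈ B, t < s) :
    (insert s B).filter (fun t => t < s) = B := by
  ext t
  simp only [Finset.mem_filter, Finset.mem_insert]
  constructor
  · rintro ⟨rfl | ht, h2⟩
    · exact absurd h2 (lt_irrefl _)
    · exact ht
  · exact fun ht => ⟨Or.inr ht, hs t ht⟩

/-- Equality holds if `Y s` is `e` minus the sum of `d` before `s`: then the product telescopes.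
A smaller `Y` makes the product smaller. -/
theorem prod_one_sub_div_mul_le (B : Finset ℝ) (d Y : ℝ → ℝ) (e : ℝ)
    (hd : ∀ s ∈ B, 0 ≤ d s) (hY : ∀ s ∈ B, 0 < Y s) (hdY : ∀ s ∈ B, d s ≤ Y s)
    (h : ∀ s ∈ B, Y s + ∑ s' ∈ B with s' < s, d s' ≤ e) :
    (∏ s ∈ B, (1 - d s / Y s)) * e ≤ e - ∑ s ∈ B, d s := by
  induction B using Finset.induction_on_max with
  | empty => simp
  | insert s B hs ih =>
    have hsB : s ∉ B := fun hm => lt_irrefl s (hs s hm)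
    have ih' := ih (fun t ht => hd t (Finset.mem_insert_of_mem ht))
      (fun t ht => hY t (Finset.mem_insert_of_mem ht))
      (fun t ht => hdY t (Finset.mem_insert_of_mem ht)) (fun t ht => by
        have := h t (Finset.mem_insert_of_mem ht)
        rwa [Finset.filter_insert, if_neg (not_lt.2 (hs t ht).le)] at this)
    have h1 := h s (Finset.mem_insert_self _ _)
    rw [filter_lt_insert_eq hs] at h1
    rw [Finset.prod_insert hsB, Finset.sum_insert hsB]
    have hYs := hY s (Finset.mem_insert_self _ _)
    have hds := hd s (Finset.mem_insert_self _ _)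
    have hf : 0 ≤ 1 - d s / Y s :=
      sub_nonneg.2 ((div_le_one hYs).2 (hdY s (Finset.mem_insert_self _ _)))
    have hY' : d s / Y s * Y s = d s := div_mul_cancel₀ _ hYs.ne'
    nlinarith [mul_le_mul_of_nonneg_left ih' hf,
      mul_le_mul_of_nonneg_left h1 (div_nonneg hds hYs.le)]

/-- The counterpart of `prod_one_sub_div_mul_le`: a larger `Y` makes the product larger. -/
theorem le_prod_one_sub_div_mul (B : Finset ℝ) (d Y : ℝ → ℝ) (e : ℝ)
    (hd : ∀ s ∈ B, 0 ≤ d s) (hY : ∀ s ∈ B, 0 < Y s) (hdY : ∀ s ∈ B, d s ≤ Y s)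
    (h : ∀ s ∈ B, e ≤ Y s + ∑ s' ∈ B with s' < s, d s') :
    e - ∑ s ∈ B, d s ≤ (∏ s ∈ B, (1 - d s / Y s)) * e := by
  induction B using Finset.induction_on_max with
  | empty => simp
  | insert s B hs ih =>
    have hsB : s ∉ B := fun hm => lt_irrefl s (hs s hm)
    have ih' := ih (fun t ht => hd t (Finset.mem_insert_of_mem ht))
      (fun t ht => hY t (Finset.mem_insert_of_mem ht))
      (fun t ht => hdY t (Finset.mem_insert_of_mem ht)) (fun t ht => by
        have := h t (Finset.mem_insert_of_mem ht)
        rwa [Finset.filter_insert, if_neg (not_lt.2 (hs t ht).le)] at this)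
    have h1 := h s (Finset.mem_insert_self _ _)
    rw [filter_lt_insert_eq hs] at h1
    rw [Finset.prod_insert hsB, Finset.sum_insert hsB]
    have hYs := hY s (Finset.mem_insert_self _ _)
    have hds := hd s (Finset.mem_insert_self _ _)
    have hf : 0 ≤ 1 - d s / Y s :=
      sub_nonneg.2 ((div_le_one hYs).2 (hdY s (Finset.mem_insert_self _ _)))
    have hY' : d s / Y s * Y s = d s := div_mul_cancel₀ _ hYs.ne'
    nlinarith [mul_le_mul_of_nonneg_left ih' hf,
      mul_le_mul_of_nonneg_left h1 (div_nonneg hds hYs.le)]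

/-! ### The Kaplan–Meier estimator on lower sets -/

open Classical in
/-- The distinct uncensored values of the first `n` observations. -/
def deathTimes (n : ℕ) (r : ℕ → ℝ) (δ : ℕ → Prop) : Finset ℝ :=
  ((Finset.range n).filter fun k => δ k).image r

open Classical in
/-- The product of the Kaplan–Meier factors `1 - d(s) / Y(s)` over the uncensored values `s ∈ L`.
For `L = Iic t` this is the estimated survival function at `t`, for `L = Iio t` its left limit. -/
def kmProd (n : ℕ) (r : ℕ → ℝ) (δ : ℕ → Prop) (L : Set ℝ) : ℝ :=
  ∏ s ∈ (deathTimes n r δ).filter (fun s => s ∈ L),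
    (1 - (deaths n r δ s : ℝ) / (atRisk n r s : ℝ))

open Classical in
/-- The number of indices `i < n` with property `p`. -/
def countBelow (n : ℕ) (p : ℕ → Prop) : ℕ := ((Finset.range n).filter p).card

/-- The relative frequency of the indices `i < n` with property `p`. -/
def freq (n : ℕ) (p : ℕ → Prop) : ℝ := (countBelow n p : ℝ) / n

section Deterministic

variable {n : ℕ} {r : ℕ → ℝ} {δ : ℕ → Prop}

theorem countBelow_mono {p q : ℕ → Prop} (h : ∀ k < n, p k → q k) :
    countBelow n p ≤ countBelow n q := by
  classical
  refine Finset.card_le_card fun k hk => ?_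
  simp only [Finset.mem_filter, Finset.mem_range] at hk ⊢
  exact ⟨hk.1, h k hk.1 hk.2⟩

theorem countBelow_or {p q : ℕ → Prop} (h : ∀ k < n, p k → ¬ q k) :
    countBelow n (fun k => p k ∨ q k) = countBelow n p + countBelow n q := by
  classical
  unfold countBelow
  rw [← Finset.card_union_of_disjoint]
  · congr 1
    ext k
    simp only [Finset.mem_filter, Finset.mem_union]
    tauto
  · rw [Finset.disjoint_filter]
    exact fun k hk => h k (Finset.mem_range.1 hk)

theorem countBelow_or_le (p q : ℕ → Prop) :
    countBelow n (fun k => p k ∨ q k) ≤ countBelow n p + countBelow n q := by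
  classical
  refine (Finset.card_le_card fun k hk => ?_).trans (Finset.card_union_le _ _)
  simp only [Finset.mem_filter, Finset.mem_union] at hk ⊢
  tauto

theorem mem_deathTimes {s : ℝ} : s ∈ deathTimes n r δ ↔ ∃ k < n, δ k ∧ r k = s := by
  classical
  simp [deathTimes, and_assoc]

theorem deaths_le_atRisk (s : ℝ) : deaths n r δ s ≤ atRisk n r s := by
  classical
  refine Finset.card_le_card fun k hk => ?_
  simp only [Finset.mem_filter] at hk ⊢
  exact ⟨hk.1, hk.2.2.ge⟩

theorem atRisk_pos {s : ℝ} {k : ℕ} (hk : k < n) (hs : s ≤ r k) : 0 < atRisk n r s := by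
  classical
  exact Finset.card_pos.2 ⟨k, by simp [hk, hs]⟩

theorem kmFactor_nonneg (s : ℝ) : 0 ≤ 1 - (deaths n r δ s : ℝ) / (atRisk n r s : ℝ) := by
  refine sub_nonneg.2 (div_le_one_of_le₀ ?_ (Nat.cast_nonneg _))
  exact_mod_cast deaths_le_atRisk s

theorem kmFactor_le_one (s : ℝ) : 1 - (deaths n r δ s : ℝ) / (atRisk n r s : ℝ) ≤ 1 :=
  sub_le_self _ (by positivity)

theorem kmProd_nonneg (L : Set ℝ) : 0 ≤ kmProd n r δ L :=
  Finset.prod_nonneg fun _ _ => kmFactor_nonneg _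

theorem kmProd_empty : kmProd n r δ ∅ = 1 := by
  simp [kmProd]

theorem freq_nonneg (p : ℕ → Prop) : 0 ≤ freq n p := by unfold freq; positivity

theorem freq_eq_zero {p : ℕ → Prop} (h : ∀ k < n, ¬ p k) : freq n p = 0 := by
  classical
  rw [freq, countBelow, Finset.filter_eq_empty_iff.2 fun k hk => h k (Finset.mem_range.1 hk),
    Finset.card_empty, Nat.cast_zero, zero_div]

theorem kmProd_eq_mul {L L' : Set ℝ} (hL : L ⊆ L') :
    kmProd n r δ L' = kmProd n r δ L * kmProd n r δ (L' \ L) := by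
  classical
  unfold kmProd
  rw [← Finset.prod_union]
  · refine Finset.prod_congr ?_ fun _ _ => rfl
    ext s
    have := @hL s
    simp only [Finset.mem_filter, Finset.mem_union, Set.mem_sdiff]
    tauto
  · rw [Finset.disjoint_left]
    intro s h1 h2
    simp only [Finset.mem_filter, Set.mem_sdiff] at h1 h2
    exact h2.2.2 h1.2

theorem kmProd_le_one (L : Set ℝ) : kmProd n r δ L ≤ 1 :=
  Finset.prod_le_one (fun _ _ => kmFactor_nonneg _) fun _ _ => kmFactor_le_one _

theorem kmProd_anti {L L' : Set ℝ} (hL : L ⊆ L') : kmProd n r δ L' ≤ kmProd n r δ L := by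
  rw [kmProd_eq_mul hL]
  exact mul_le_of_le_one_right (kmProd_nonneg _) (kmProd_le_one _)

theorem sum_deaths (B : Finset ℝ) :
    ∑ s ∈ B, deaths n r δ s = countBelow n (fun k => δ k ∧ r k ∈ B) := by
  classical
  unfold countBelow
  rw [Finset.card_eq_sum_card_fiberwise (f := r) (t := B)]
  · refine Finset.sum_congr rfl fun s hs => ?_
    unfold deaths
    congr 1
    ext k
    simp only [Finset.mem_filter]
    constructor
    · rintro ⟨h1, h2, rfl⟩
      exact ⟨⟨h1, h2, hs⟩, rfl⟩
    · rintro ⟨⟨h1, h2, -⟩, h4⟩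
      exact ⟨h1, h2, h4⟩
  · intro k hk
    simp only [Finset.coe_filter, Set.mem_ofPred_eq] at hk
    exact hk.2.2

theorem atRisk_eq_countBelow (s : ℝ) : atRisk n r s = countBelow n (fun k => s ≤ r k) := rfl

open Classical in
theorem countBelow_deaths_eq_sum (L : Set ℝ) :
    countBelow n (fun k => δ k ∧ r k ∈ L) =
      ∑ s ∈ (deathTimes n r δ).filter (fun s => s ∈ L), deaths n r δ s := by
  rw [sum_deaths]
  refine le_antisymm (countBelow_mono fun k hk h => ⟨h.1, ?_⟩) (countBelow_mono fun k hk h =>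
    ⟨h.1, (Finset.mem_filter.1 h.2).2⟩)
  exact Finset.mem_filter.2 ⟨mem_deathTimes.2 ⟨k, hk, h.1, rfl⟩, h.2⟩

open Classical in
/-- Moving all censorings between `L` and `L'` behind the uncensored values there makes the product
telescope, and increases it. -/
theorem kmProd_diff_mul_le {L L' : Set ℝ} (hL : IsLowerSet L) :
    kmProd n r δ (L' \ L) * (countBelow n (fun k => r k ∉ L) : ℝ) ≤
      (countBelow n (fun k => r k ∉ L) : ℝ) -
        (countBelow n (fun k => δ k ∧ r k ∈ L' \ L) : ℝ) := by
  have hdiff : ∀ s ∈ L' \ L, s ∉ L := fun s hs => hs.2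
  generalize L' \ L = M at hdiff ⊢
  rw [countBelow_deaths_eq_sum (δ := δ) (r := r) M, Nat.cast_sum]
  refine prod_one_sub_div_mul_le _ (fun s => (deaths n r δ s : ℝ))
    (fun s => (atRisk n r s : ℝ)) _ (fun _ _ => Nat.cast_nonneg _) ?_
    (fun s _ => by exact_mod_cast deaths_le_atRisk s) ?_
  · intro s hs
    obtain ⟨k, hk, -, rfl⟩ := mem_deathTimes.1 (Finset.mem_filter.1 hs).1
    exact_mod_cast atRisk_pos hk le_rfl
  · intro s hs
    have hsL : s ∉ L := hdiff s (Finset.mem_filter.1 hs).2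
    rw [← Nat.cast_sum, sum_deaths, atRisk_eq_countBelow]
    norm_cast
    rw [← countBelow_or]
    · refine countBelow_mono fun k hk h => ?_
      simp only [Finset.mem_filter] at h
      rcases h with h2 | ⟨-, ⟨-, h2⟩, -⟩
      · exact fun h => hsL (hL h2 h)
      · exact hdiff _ h2
    · intro k _ h1 h2
      exact absurd (Finset.mem_filter.1 h2.2).2 (not_lt.2 h1)

/-- Moving all censorings between `L` and `L'` before the uncensored values there makes the product
telescope, and decreases it. -/
theorem le_kmProd_diff_mul {L L' : Set ℝ} (hL' : IsLowerSet L') :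
    (countBelow n (fun k => r k ∉ L') : ℝ) ≤ kmProd n r δ (L' \ L) *
      ((countBelow n (fun k => δ k ∧ r k ∈ L' \ L) : ℝ) +
        (countBelow n (fun k => r k ∉ L') : ℝ)) := by
  classical
  have key := le_prod_one_sub_div_mul ((deathTimes n r δ).filter (fun s => s ∈ L' \ L))
    (fun s => (deaths n r δ s : ℝ)) (fun s => (atRisk n r s : ℝ))
    ((countBelow n (fun k => δ k ∧ r k ∈ L' \ L) : ℝ) + (countBelow n (fun k => r k ∉ L') : ℝ))
    (fun _ _ => Nat.cast_nonneg _) ?_ (fun s _ => by exact_mod_cast deaths_le_atRisk s) ?_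
  · have h0 := countBelow_deaths_eq_sum (n := n) (δ := δ) (r := r) (L' \ L)
    rw [← Nat.cast_sum] at key
    unfold kmProd
    convert key using 1
    · rw [h0, eq_sub_iff_add_eq, add_comm]
      congr!
    · congr!
  · intro s hs
    obtain ⟨k, hk, -, rfl⟩ := mem_deathTimes.1 (Finset.mem_filter.1 hs).1
    exact_mod_cast atRisk_pos hk le_rfl
  · intro s hs
    have hsL : s ∈ L' := (Finset.mem_filter.1 hs).2.1
    rw [← Nat.cast_sum, sum_deaths, atRisk_eq_countBelow]
    norm_cast
    rw [← countBelow_or]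
    · refine (countBelow_mono fun k hk h => ?_).trans (countBelow_or_le _ _)
      simp only [Finset.mem_filter, mem_deathTimes]
      rcases h with ⟨h2, h3⟩ | h2
      · rcases le_or_gt s (r k) with h | h
        · exact Or.inl h
        · exact Or.inr ⟨h2, ⟨⟨k, hk, h2, rfl⟩, h3⟩, h⟩
      · refine Or.inl ?_
        by_contra h
        exact h2 (hL' (not_le.1 h).le hsL)
    · intro k _ h1 h2
      exact h2 h1.2.1

/-- The upper bound of `kmProd_diff_mul_le` in terms of frequencies. It holds by the convention
`x / 0 = 0` also if nobody is at risk beyond `L`. -/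
theorem kmProd_le_mul {L L' : Set ℝ} (hL : IsLowerSet L) (h : L ⊆ L') :
    kmProd n r δ L' ≤ kmProd n r δ L *
      (1 - freq n (fun k => δ k ∧ r k ∈ L' \ L) / freq n (fun k => r k ∉ L)) := by
  classical
  rw [kmProd_eq_mul h]
  refine mul_le_mul_of_nonneg_left ?_ (kmProd_nonneg _)
  rcases (freq_nonneg (n := n) (fun k => r k ∉ L)).eq_or_lt with h0 | h0
  · rw [← h0, div_zero, sub_zero]
    exact kmProd_le_one _
  · have hn : (0 : ℝ) < n := by
      rcases Nat.eq_zero_or_pos n with rfl | hn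
      · simp [freq] at h0
      · exact_mod_cast hn
    have key := kmProd_diff_mul_le (n := n) (r := r) (δ := δ) (L' := L') hL
    rw [one_sub_div h0.ne', le_div_iff₀ h0]
    unfold freq
    rw [← mul_div_assoc, ← sub_div]
    gcongr

/-- The lower bound of `le_kmProd_diff_mul` in terms of frequencies. It holds by the convention
`x / 0 = 0` also if the denominator vanishes. -/
theorem mul_le_kmProd {L L' : Set ℝ} (hL' : IsLowerSet L') (h : L ⊆ L') :
    kmProd n r δ L * (freq n (fun k => r k ∉ L') /
        (freq n (fun k => δ k ∧ r k ∈ L' \ L) + freq n (fun k => r k ∉ L'))) ≤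
      kmProd n r δ L' := by
  classical
  rw [kmProd_eq_mul h]
  refine mul_le_mul_of_nonneg_left ?_ (kmProd_nonneg _)
  refine div_le_of_le_mul₀ (add_nonneg (freq_nonneg _) (freq_nonneg _)) (kmProd_nonneg _) ?_
  have key := le_kmProd_diff_mul (n := n) (r := r) (δ := δ) (L := L) hL'
  unfold freq
  rw [← add_div, ← mul_div_assoc]
  gcongr

/-! ### Redistributed mass -/

open Classical in
/-- The Kaplan–Meier weights of the observations in a lower set `L` add up to the estimated
probability of `L`. -/
theorem sum_kmWeight {L : Set ℝ} (hL : IsLowerSet L) :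
    ∑ j ∈ (Finset.range n).filter (fun j => δ j ∧ r j ∈ L), kmWeight n r δ j =
      1 - kmProd n r δ L := by
  unfold kmProd
  rw [Finset.prod_one_sub_ordered, sub_sub_cancel]
  rw [← Finset.sum_fiberwise_of_maps_to (g := r)
    (t := (deathTimes n r δ).filter (fun s => s ∈ L))]
  · refine Finset.sum_congr rfl fun s hs => ?_
    have hsL := (Finset.mem_filter.1 hs).2
    have h1 : ∀ j ∈ ((Finset.range n).filter (fun j => δ j ∧ r j ∈ L)).filter (fun j => r j = s),
        kmWeight n r δ j = kmSurvivalLeft n r δ s / (atRisk n r s : ℝ) := by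
      intro j hj
      simp only [Finset.mem_filter] at hj
      rw [kmWeight, if_pos hj.1.2.1, hj.2]
    rw [Finset.sum_congr rfl h1, Finset.sum_const, nsmul_eq_mul]
    have h2 : (((Finset.range n).filter (fun j => δ j ∧ r j ∈ L)).filter
        (fun j => r j = s)).card = deaths n r δ s := by
      unfold deaths
      congr 1
      ext k
      simp only [Finset.mem_filter]
      constructor
      · rintro ⟨⟨h1, h2, -⟩, h4⟩
        exact ⟨h1, h2, h4⟩
      · intro h
        exact ⟨⟨h.1, h.2.1, h.2.2.symm ▸ hsL⟩, h.2.2⟩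
    have h3 : ((deathTimes n r δ).filter (fun s => s ∈ L)).filter (fun j => j < s) =
        (deathTimes n r δ).filter (fun j => j < s) := by
      ext t
      simp only [Finset.mem_filter]
      exact ⟨fun h => ⟨h.1.1, h.2⟩, fun h => ⟨⟨h.1, hL h.2.le hsL⟩, h.2⟩⟩
    rw [h2, h3, kmSurvivalLeft]
    simp only [deathTimes]
    ring
  · intro j hj
    simp only [Finset.mem_filter, mem_deathTimes, Finset.mem_range] at hj ⊢
    exact ⟨⟨j, hj.1, hj.2.1, rfl⟩, hj.2.2⟩

open Classical in
theorem sum_kmWeight_diff {L L' : Set ℝ} (hL : IsLowerSet L) (hL' : IsLowerSet L')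
    (h : L ⊆ L') :
    ∑ j ∈ (Finset.range n).filter (fun j => δ j ∧ r j ∈ L' \ L), kmWeight n r δ j =
      kmProd n r δ L - kmProd n r δ L' := by
  have h1 := sum_kmWeight (n := n) (r := r) (δ := δ) hL
  have h2 := sum_kmWeight (n := n) (r := r) (δ := δ) hL'
  have h3 : (Finset.range n).filter (fun j => δ j ∧ r j ∈ L') =
      (Finset.range n).filter (fun j => δ j ∧ r j ∈ L) ∪
      (Finset.range n).filter (fun j => δ j ∧ r j ∈ L' \ L) := by
    ext j
    have := @h (r j)
    simp only [Finset.mem_filter, Finset.mem_union, Set.mem_sdiff]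
    tauto
  rw [h3, Finset.sum_union] at h2
  · linarith
  · rw [Finset.disjoint_filter]
    intro j _ h1 h2
    exact h2.2.2 h1.2

/-- The proportion of the mass of the `i`-th observation that is put on `Iic a`. For a censored
observation the numerator and the denominator are the Kaplan–Meier masses of `Ioc (r i) a` and of
`Ioi (r i)`; the latter is not `kmProd n r δ (Iic (r i))`, since the Kaplan–Meier weights need not
add up to one. -/
def massBelow (n : ℕ) (r : ℕ → ℝ) (δ : ℕ → Prop) (a : ℝ) (i : ℕ) : ℝ :=
  open Classical in
  if r i ≤ a then
    if δ i then 1 else (kmProd n r δ (Set.Iic (r i)) - kmProd n r δ (Set.Iic a)) /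
      (kmProd n r δ (Set.Iic (r i)) - kmProd n r δ Set.univ)
  else 0

open Classical in
theorem sum_redistributedMass (a : ℝ) {i : ℕ} (hi : i < n) :
    ∑ j ∈ Finset.range n, (if r j ≤ a then redistributedMass n r δ i j else 0) =
      massBelow n r δ a i / n := by
  unfold redistributedMass massBelow
  by_cases hδ : δ i
  · simp only [if_pos hδ]
    rw [Finset.sum_eq_single i]
    · simp only [if_true]; split_ifs <;> simp
    · intro j _ hj
      simp [hj.symm]
    · intro h
      exact absurd (Finset.mem_range.2 hi) h
  · simp only [if_neg hδ]
    have hden : ∑ k ∈ uncensoredRight n r δ i, kmWeight n r δ k =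
        kmProd n r δ (Set.Iic (r i)) - kmProd n r δ Set.univ := by
      rw [← sum_kmWeight_diff (isLowerSet_Iic _) isLowerSet_univ (Set.subset_univ _)]
      refine Finset.sum_congr ?_ fun _ _ => rfl
      unfold uncensoredRight
      ext j
      simp [and_comm]
    rw [hden]
    have h1 : ∀ j, (if r j ≤ a then (if j ∈ uncensoredRight n r δ i then 1 / (n : ℝ) *
        (kmWeight n r δ j / (kmProd n r δ (Set.Iic (r i)) - kmProd n r δ Set.univ)) else 0)
        else 0) = if (r j ≤ a ∧ j ∈ uncensoredRight n r δ i) then kmWeight n r δ j *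
          (1 / (n : ℝ) / (kmProd n r δ (Set.Iic (r i)) - kmProd n r δ Set.univ)) else 0 := by
      intro j
      by_cases h1 : r j ≤ a <;> by_cases h2 : j ∈ uncensoredRight n r δ i <;> simp [h1, h2]; ring
    simp only [h1]
    rw [← Finset.sum_filter, ← Finset.sum_mul]
    by_cases hr : r i ≤ a
    · rw [if_pos hr, ← sum_kmWeight_diff (isLowerSet_Iic _) (isLowerSet_Iic a)
        (Set.Iic_subset_Iic.2 hr)]
      have : (Finset.range n).filter (fun j => r j ≤ a ∧ j ∈ uncensoredRight n r δ i) =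
          (Finset.range n).filter (fun j => δ j ∧ r j ∈ Set.Iic a \ Set.Iic (r i)) := by
        ext j
        simp only [uncensoredRight, Finset.mem_filter, Set.mem_sdiff, Set.mem_Iic, not_le]
        tauto
      rw [this, mul_div_assoc', mul_one_div, div_right_comm]
      congr!
    · rw [if_neg hr, Finset.filter_eq_empty_iff.2, Finset.sum_empty, zero_mul, zero_div]
      intro j _ h
      simp only [uncensoredRight, Finset.mem_filter] at h
      exact hr (h.2.2.1.le.trans h.1)

open Classical in
/-- The mass that the observations `i < n` with property `q` put on `Iic a` altogether. -/
def massFreq (n : ℕ) (r : ℕ → ℝ) (δ : ℕ → Prop) (a : ℝ) (q : ℕ → Prop) : ℝ :=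
  (∑ i ∈ (Finset.range n).filter q, massBelow n r δ a i) / n

theorem redistributedDistribution_eq {p : ℕ} (x : ℕ → Fin p → ℝ) (a : ℝ) (v : Fin p → ℝ) :
    redistributedDistribution n r δ x a v = massFreq n r δ a (fun i => x i ≤ v) := by
  classical
  unfold redistributedDistribution massFreq
  rw [Finset.sum_div, Finset.sum_filter]
  refine Finset.sum_congr rfl fun i hi => ?_
  rw [← sum_redistributedMass a (Finset.mem_range.1 hi)]
  by_cases h : x i ≤ v <;> simp [h]

theorem massBelow_nonneg (a : ℝ) (i : ℕ) : 0 ≤ massBelow n r δ a i := by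
  unfold massBelow
  split_ifs with h1 h2
  · exact zero_le_one
  · exact div_nonneg (sub_nonneg.2 (kmProd_anti (Set.Iic_subset_Iic.2 h1)))
      (sub_nonneg.2 (kmProd_anti (Set.subset_univ _)))
  · exact le_rfl

theorem massBelow_mono {a b : ℝ} (h : a ≤ b) (i : ℕ) :
    massBelow n r δ a i ≤ massBelow n r δ b i := by
  unfold massBelow
  by_cases h1 : r i ≤ a
  · rw [if_pos h1, if_pos (h1.trans h)]
    split_ifs with h2
    · exact le_rfl
    · refine div_le_div_of_nonneg_right (sub_le_sub_left (kmProd_anti (Set.Iic_subset_Iic.2 h)) _)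
        (sub_nonneg.2 (kmProd_anti (Set.subset_univ _)))
  · rw [if_neg h1]
    exact massBelow_nonneg b i

theorem massBelow_le_one (a : ℝ) (i : ℕ) : massBelow n r δ a i ≤ 1 := by
  unfold massBelow
  split_ifs with h1 h2
  · exact le_rfl
  · exact div_le_one_of_le₀ (sub_le_sub_left (kmProd_anti (Set.subset_univ _)) _)
      (sub_nonneg.2 (kmProd_anti (Set.subset_univ _)))
  · exact zero_le_one

theorem massFreq_mono {a b : ℝ} {p q : ℕ → Prop} (hab : a ≤ b) (hpq : ∀ i, p i → q i) :
    massFreq n r δ a p ≤ massFreq n r δ b q := by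
  classical
  refine div_le_div_of_nonneg_right ?_ (Nat.cast_nonneg _)
  refine (Finset.sum_le_sum fun i _ => massBelow_mono hab i).trans ?_
  refine Finset.sum_le_sum_of_subset_of_nonneg ?_ fun i _ _ => massBelow_nonneg b i
  exact Finset.monotone_filter_right _ fun i _ h => hpq i h

theorem massFreq_le_freq (a : ℝ) (q : ℕ → Prop) : massFreq n r δ a q ≤ freq n q := by
  classical
  refine div_le_div_of_nonneg_right ?_ (Nat.cast_nonneg _)
  refine (Finset.sum_le_sum fun i _ => massBelow_le_one a i).trans ?_
  simp [countBelow]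

end Deterministic

/-- A squeeze theorem in which the limits of the two bounds are only close to `l`. -/
theorem tendsto_of_forall_sandwich {f : ℕ → ℝ} {l : ℝ}
    (h : ∀ ε > 0, ∃ (lo hi : ℕ → ℝ) (a b : ℝ), Tendsto lo atTop (𝓝 a) ∧ Tendsto hi atTop (𝓝 b) ∧
      (∀ᶠ n in atTop, lo n ≤ f n) ∧ (∀ᶠ n in atTop, f n ≤ hi n) ∧ l - ε ≤ a ∧ b ≤ l + ε) :
    Tendsto f atTop (𝓝 l) := by
  refine tendsto_order.2 ⟨fun a' ha' => ?_, fun b' hb' => ?_⟩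
  · obtain ⟨lo, -, a, -, hlo, -, h1, -, h2, -⟩ := h ((l - a') / 2) (by linarith)
    filter_upwards [h1, hlo.eventually (lt_mem_nhds (show a' < a by linarith))] with n h3 h4
    exact h4.trans_le h3
  · obtain ⟨-, hi, -, b, -, hhi, -, h1, -, h2⟩ := h ((b' - l) / 2) (by linarith)
    filter_upwards [h1, hhi.eventually (gt_mem_nhds (show b < b' by linarith))] with n h3 h4
    exact h3.trans_lt h4

/-! ### Chains of half-lines with small cells -/

section Chains

/-- A finite chain `∅ = L 0 ⊆ L 1 ⊆ ⋯ ⊆ L m = Iic a` of half-lines. Its differences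
`L (k + 1) \ L k` cut `Iic a` into cells. The values `L k` for `k > m` do not matter. Starting from
the empty set makes the unbounded first cell a cell like the others. -/
structure IsLowerChain (a : ℝ) (m : ℕ) (L : ℕ → Set ℝ) : Prop where
  zero : L 0 = ∅
  last : L m = Set.Iic a
  mono : Monotone L
  exists_eq_Iic : ∀ k, ∃ t, L (k + 1) = Set.Iic t

namespace IsLowerChain

variable {a : ℝ} {m : ℕ} {L : ℕ → Set ℝ}

theorem isLowerSet (hL : IsLowerChain a m L) : ∀ k, IsLowerSet (L k)
  | 0 => hL.zero ▸ isLowerSet_empty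
  | k + 1 => by
    obtain ⟨t, ht⟩ := hL.exists_eq_Iic k
    exact ht ▸ isLowerSet_Iic t

theorem measurableSet (hL : IsLowerChain a m L) (k : ℕ) : MeasurableSet (L k) :=
  (hL.isLowerSet k).ordConnected.measurableSet

theorem exists_mem_diff (hL : IsLowerChain a m L) {s : ℝ} (hs : s ≤ a) :
    ∃ k < m, s ∈ L (k + 1) \ L k := by
  classical
  have hex : ∃ k, s ∈ L k := ⟨m, hL.last ▸ hs⟩
  have h0 : Nat.find hex ≠ 0 := by
    intro h
    have := Nat.find_spec hex
    rw [h, hL.zero] at this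
    exact this
  obtain ⟨k, hk⟩ := Nat.exists_eq_succ_of_ne_zero h0
  have hle : Nat.find hex ≤ m := Nat.find_min' hex (hL.last ▸ hs)
  have hspec := Nat.find_spec hex
  rw [hk] at hspec
  exact ⟨k, by omega, hspec, Nat.find_min hex (by omega)⟩

theorem eq_of_mem_diff (hL : IsLowerChain a m L) {s : ℝ} {j k : ℕ} (hj : s ∈ L (j + 1) \ L j)
    (hk : s ∈ L (k + 1) \ L k) : j = k := by
  by_contra h
  rcases Nat.lt_or_gt_of_ne h with h | h
  · exact hk.2 (hL.mono h hj.1)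
  · exact hj.2 (hL.mono h hk.1)

end IsLowerChain

theorem measure_diagonal_eq_zero (μ ν : Measure ℝ) [IsFiniteMeasure μ] [IsFiniteMeasure ν]
    (h : ∀ s, μ {s} = 0 ∨ ν {s} = 0) : (μ.prod ν) (Set.diagonal ℝ) = 0 := by
  rw [Measure.measure_prod_null measurableSet_diagonal]
  -- the sections of the diagonal are singletons, and `ν` charges only countably many of them
  have hc : {s : ℝ | 0 < ν {s}}.Countable :=
    Measure.countable_meas_pos_of_disjoint_iUnion (fun s => measurableSet_singleton s)
      (fun s t hst => by simpa [Function.onFun] using hst)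
  have h0 : μ {s : ℝ | 0 < ν {s}} = 0 := by
    rw [← Set.biUnion_of_singleton {s : ℝ | 0 < ν {s}}, measure_biUnion_null_iff hc]
    intro s hs
    exact (h s).resolve_right (ne_of_gt hs)
  filter_upwards [measure_eq_zero_iff_ae_notMem.1 h0] with s hs
  have : Prod.mk s ⁻¹' Set.diagonal ℝ = {s} := by
    ext t
    simp [eq_comm]
  rw [this]
  simpa using hs

/-- If `μ` and `ν` have no common atom, then the diagonal is a null set of `μ × ν`, so the squares
of the cells of a fine chain have a small total measure. -/
theorem exists_isLowerChain (μ ν : Measure ℝ) [IsProbabilityMeasure μ] [IsProbabilityMeasure ν]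
    (h : ∀ s, μ {s} = 0 ∨ ν {s} = 0) (a : ℝ) {ε : ℝ} (hε : 0 < ε) :
    ∃ m L, IsLowerChain a m L ∧
      ∑ k ∈ Finset.range m, μ.real (L (k + 1) \ L k) * ν.real (L (k + 1) \ L k) ≤ ε := by
  -- a strip around the diagonal of measure less than `ε / 2`
  obtain ⟨j, hj⟩ : ∃ j : ℕ,
      (μ.prod ν).real {q : ℝ × ℝ | |q.1 - q.2| ≤ 1 / ((j : ℝ) + 1)} < ε / 2 := by
    have hlim := tendsto_measure_iInter_atTop (μ := μ.prod ν)
      (s := fun j : ℕ => {q : ℝ × ℝ | |q.1 - q.2| ≤ 1 / ((j : ℝ) + 1)})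
      (fun j => (measurableSet_le (by fun_prop) measurable_const).nullMeasurableSet)
      (fun i j hij q hq => le_trans (Set.mem_ofPred_eq ▸ hq) (by
        have : (i : ℝ) ≤ j := by exact_mod_cast hij
        gcongr)) ⟨0, measure_ne_top _ _⟩
    have hint : ⋂ j : ℕ, {q : ℝ × ℝ | |q.1 - q.2| ≤ 1 / ((j : ℝ) + 1)} = Set.diagonal ℝ := by
      ext q
      simp only [Set.mem_iInter, Set.mem_ofPred_eq, Set.mem_diagonal_iff]
      constructor
      · intro hq
        have : |q.1 - q.2| ≤ 0 :=
          ge_of_tendsto' tendsto_one_div_add_atTop_nhds_zero_nat hq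
        exact sub_eq_zero.1 (abs_nonpos_iff.1 this)
      · intro hq j
        rw [hq, sub_self, abs_zero]
        positivity
    rw [hint, measure_diagonal_eq_zero μ ν h] at hlim
    have hlim' := (ENNReal.tendsto_toReal ENNReal.zero_ne_top).comp hlim
    exact (hlim'.eventually (gt_mem_nhds (by simpa using half_pos hε))).exists
  set w : ℝ := 1 / ((j : ℝ) + 1) with hw
  have hw0 : 0 < w := by positivity
  -- an unbounded first cell of measure less than `ε / 2`; the other cells have width `w`
  obtain ⟨k, hk⟩ : ∃ k : ℕ, μ.real (Set.Iic (a - k * w)) < ε / 2 := by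
    have h1 : Tendsto (fun k : ℕ => a - k * w) atTop atBot :=
      tendsto_atBot_add_const_left _ a
        (tendsto_neg_atTop_atBot.comp (tendsto_natCast_atTop_atTop.atTop_mul_const hw0))
    have h2 := (tendsto_cdf_atBot μ).comp h1
    obtain ⟨k, hk⟩ := (h2.eventually (gt_mem_nhds (half_pos hε))).exists
    refine ⟨k, ?_⟩
    simpa [cdf_eq_real] using hk
  set f : ℕ → ℝ := fun i => a - ((k : ℝ) - i) * w with hf
  have hfm : Monotone f := by
    intro i i' hi
    have : (i : ℝ) ≤ i' := by exact_mod_cast hi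
    simp only [hf]
    nlinarith
  refine ⟨k + 1, fun i => Nat.casesOn i ∅ fun i => Set.Iic (f i), ⟨rfl, ?_, ?_, ?_⟩, ?_⟩
  · simp [hf]
  · refine monotone_nat_of_le_succ ?_
    rintro (_ | i)
    · exact Set.empty_subset _
    · exact Set.Iic_subset_Iic.2 (hfm (Nat.le_succ i))
  · exact fun i => ⟨f i, rfl⟩
  rw [Finset.sum_range_succ']
  have h0 : μ.real (Set.Iic (f 0) \ ∅) * ν.real (Set.Iic (f 0) \ ∅) ≤ ε / 2 := by
    rw [Set.sdiff_empty]
    have : f 0 = a - k * w := by simp [hf]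
    rw [this]
    exact (mul_le_of_le_one_right measureReal_nonneg measureReal_le_one).trans hk.le
  have h1 : ∑ i ∈ Finset.range k, μ.real (Set.Iic (f (i + 1)) \ Set.Iic (f i)) *
      ν.real (Set.Iic (f (i + 1)) \ Set.Iic (f i)) ≤ ε / 2 := by
    have hdisj := hfm.pairwise_disjoint_on_Ioc_succ
    have h2 : ∀ i, μ.real (Set.Iic (f (i + 1)) \ Set.Iic (f i)) *
        ν.real (Set.Iic (f (i + 1)) \ Set.Iic (f i)) = (μ.prod ν).real
          (Set.Ioc (f i) (f (Order.succ i)) ×ˢ Set.Ioc (f i) (f (Order.succ i))) := by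
      intro i
      rw [measureReal_prod_prod, Set.Iic_sdiff_Iic]
      rfl
    simp only [h2]
    rw [← measureReal_biUnion_finset]
    · refine (measureReal_mono ?_).trans hj.le
      intro q hq
      simp only [Set.mem_iUnion, Set.mem_prod, Set.mem_Ioc, Order.succ_eq_add_one] at hq
      obtain ⟨i, -, ⟨h3, h4⟩, h5, h6⟩ := hq
      have h7 : f (i + 1) = f i + w := by
        simp only [hf]
        push_cast
        ring
      rw [h7] at h4 h6
      have h8 : |q.1 - q.2| ≤ w := abs_sub_le_iff.2 ⟨by linarith, by linarith⟩
      exact h8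
    · intro i _ i' _ hii
      exact Set.Disjoint.set_prod_left (hdisj hii) _ _
    · exact fun i _ => measurableSet_Ioc.prod measurableSet_Ioc
  exact (add_le_add h1 h0).trans (add_halves ε).le

end Chains

/-! ### The random censorship model -/

section Model

variable {Ω E : Type*} [MeasurableSpace Ω] [MeasurableSpace E]

/-- The random censorship model with covariates: the triples of a value `T i`, a covariate `X i`
and a censoring time `C i` are i.i.d., and the values are independent of the pairs of a covariate
and a censoring time. -/
structure IsRandomCensorship (P : Measure Ω) (T : ℕ → Ω → ℝ) (X : ℕ → Ω → E) (C : ℕ → Ω → ℝ) :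
    Prop where
  measurable_sample : ∀ i, Measurable (fun ω => (T i ω, X i ω, C i ω))
  iIndepFun_sample : iIndepFun (fun i ω => (T i ω, X i ω, C i ω)) P
  identDistrib_sample : ∀ i, IdentDistrib (fun ω => (T i ω, X i ω, C i ω))
    (fun ω => (T 0 ω, X 0 ω, C 0 ω)) P P
  indepFun : IndepFun (T 0) (fun ω => (X 0 ω, C 0 ω)) P

variable {P : Measure Ω} {T : ℕ → Ω → ℝ} {X : ℕ → Ω → E} {C : ℕ → Ω → ℝ}

namespace IsRandomCensorship

theorem measurable_T (h : IsRandomCensorship P T X C) (i : ℕ) : Measurable (T i) :=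
  (h.measurable_sample i).fst

theorem measurable_X (h : IsRandomCensorship P T X C) (i : ℕ) : Measurable (X i) :=
  (h.measurable_sample i).snd.fst

theorem measurable_C (h : IsRandomCensorship P T X C) (i : ℕ) : Measurable (C i) :=
  (h.measurable_sample i).snd.snd

/-- The strong law of large numbers for relative frequencies. -/
theorem ae_tendsto_freq [IsFiniteMeasure P] (h : IsRandomCensorship P T X C)
    {A : Set (ℝ × E × ℝ)} (hA : MeasurableSet A) :
    ∀ᵐ ω ∂P, Tendsto (fun n => freq n (fun i => (T i ω, X i ω, C i ω) ∈ A)) atTop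
      (𝓝 (P.real {ω | (T 0 ω, X 0 ω, C 0 ω) ∈ A})) := by
  classical
  set g : ℝ × E × ℝ → ℝ := A.indicator 1 with hg
  have hgm : Measurable g := measurable_one.indicator hA
  have key := strong_law_ae_real (μ := P) (fun i ω => g (T i ω, X i ω, C i ω)) ?_ ?_ ?_
  · filter_upwards [key] with ω hω
    convert hω using 2 with n
    · simp only [freq, countBelow, hg]
      congr 1
      rw [Finset.card_filter]
      push_cast
      refine Finset.sum_congr rfl fun i _ => ?_
      simp [Set.indicator_apply]
    · have h1 : (fun ω => g (T 0 ω, X 0 ω, C 0 ω)) =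
          Set.indicator {ω | (T 0 ω, X 0 ω, C 0 ω) ∈ A} 1 := by
        ext ω
        simp [hg, Set.indicator_apply]
      exact (h1 ▸ integral_indicator_one (h.measurable_sample 0 hA)).symm
  · exact Integrable.of_bound (hgm.comp (h.measurable_sample 0)).aestronglyMeasurable 1
      (Eventually.of_forall fun ω => by
        simp only [hg, Set.indicator_apply]
        split_ifs <;> simp)
  · intro i j hij
    exact (h.iIndepFun_sample.indepFun hij).comp hgm hgm
  · exact fun i => (h.identDistrib_sample i).comp hgm

/-- The independence of the values from the covariates and the censoring times. -/
theorem real_and (h : IsRandomCensorship P T X C) {A : Set ℝ} {B : Set (E × ℝ)}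
    (hA : MeasurableSet A) (hB : MeasurableSet B) :
    P.real {ω | T 0 ω ∈ A ∧ (X 0 ω, C 0 ω) ∈ B} =
      P.real {ω | T 0 ω ∈ A} * P.real {ω | (X 0 ω, C 0 ω) ∈ B} := by
  have := h.indepFun.measure_inter_preimage_eq_mul A B hA hB
  simp only [measureReal_def, ← ENNReal.toReal_mul]
  exact congrArg ENNReal.toReal this

theorem real_and_censoring (h : IsRandomCensorship P T X C) {A B : Set ℝ}
    (hA : MeasurableSet A) (hB : MeasurableSet B) :
    P.real {ω | T 0 ω ∈ A ∧ C 0 ω ∈ B} =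
      P.real {ω | T 0 ω ∈ A} * P.real {ω | C 0 ω ∈ B} :=
  h.real_and (B := Prod.snd ⁻¹' B) hA (measurable_snd hB)

end IsRandomCensorship

end Model

/-! ### Consistency of the Kaplan–Meier estimator -/

theorem min_mem_iff_of_isLowerSet {L : Set ℝ} (hL : IsLowerSet L) {s t : ℝ} :
    min s t ∈ L ↔ s ∈ L ∨ t ∈ L := by
  refine ⟨fun h => ?_, fun h => h.elim (hL (min_le_left _ _)) (hL (min_le_right _ _))⟩
  rcases min_choice s t with h' | h' <;> rw [h'] at h
  · exact Or.inl h
  · exact Or.inr h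

theorem prod_bounds {l u s : ℕ → ℝ} (m : ℕ) (h0 : s 0 = 1) (hl : ∀ k < m, 0 ≤ l k)
    (hu : ∀ k < m, 0 ≤ u k)
    (hls : ∀ k < m, s k * l k ≤ s (k + 1)) (hsu : ∀ k < m, s (k + 1) ≤ s k * u k) :
    ∏ k ∈ Finset.range m, l k ≤ s m ∧ s m ≤ ∏ k ∈ Finset.range m, u k := by
  induction m with
  | zero => simp [h0]
  | succ m ih =>
    obtain ⟨h1, h2⟩ := ih (fun k hk => hl k (by omega)) (fun k hk => hu k (by omega))
      (fun k hk => hls k (by omega)) (fun k hk => hsu k (by omega))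
    rw [Finset.prod_range_succ, Finset.prod_range_succ]
    exact ⟨(mul_le_mul_of_nonneg_right h1 (hl m (by omega))).trans (hls m (by omega)),
      (hsu m (by omega)).trans (mul_le_mul_of_nonneg_right h2 (hu m (by omega)))⟩

theorem prod_sub_prod_le {l u : ℕ → ℝ} (m : ℕ) (hl : ∀ k < m, 0 ≤ l k)
    (hlu : ∀ k < m, l k ≤ u k) (hu : ∀ k < m, u k ≤ 1) :
    ∏ k ∈ Finset.range m, u k - ∏ k ∈ Finset.range m, l k ≤ ∑ k ∈ Finset.range m, (u k - l k) := by
  induction m with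
  | zero => simp
  | succ m ih =>
    have h := ih (fun k hk => hl k (by omega)) (fun k hk => hlu k (by omega))
      (fun k hk => hu k (by omega))
    rw [Finset.prod_range_succ, Finset.prod_range_succ, Finset.sum_range_succ]
    have h1 : ∏ k ∈ Finset.range m, l k ≤ 1 :=
      Finset.prod_le_one (fun k hk => hl k (by rw [Finset.mem_range] at hk; omega))
        fun k hk => (hlu k (by rw [Finset.mem_range] at hk; omega)).trans
          (hu k (by rw [Finset.mem_range] at hk; omega))
    have h2 : ∏ k ∈ Finset.range m, l k ≤ ∏ k ∈ Finset.range m, u k :=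
      Finset.prod_le_prod (fun k hk => hl k (by rw [Finset.mem_range] at hk; omega))
        fun k hk => hlu k (by rw [Finset.mem_range] at hk; omega)
    have h3 := hl m (by omega)
    have h4 := hlu m (by omega)
    have h5 := hu m (by omega)
    nlinarith [mul_nonneg (sub_nonneg.2 h2) (sub_nonneg.2 h5),
      mul_nonneg (sub_nonneg.2 h1) (sub_nonneg.2 h4)]

section Law

variable {Ω : Type*} [MeasurableSpace Ω] {P : Measure Ω} [IsProbabilityMeasure P] {f : Ω → ℝ}

theorem real_mem_diff {L L' : Set ℝ} (hf : Measurable f) (hLL : L ⊆ L')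
    (hm' : MeasurableSet L') :
    P.real {ω | f ω ∈ L' \ L} = P.real {ω | f ω ∉ L} - P.real {ω | f ω ∉ L'} := by
  have : {ω | f ω ∈ L' \ L} = {ω | f ω ∉ L} \ {ω | f ω ∉ L'} := by
    ext ω
    simp only [Set.mem_ofPred_eq, Set.mem_sdiff, not_not]
    tauto
  rw [this, measureReal_sdiff]
  · exact fun ω hω hω' => hω (hLL hω')
  · exact hf hm'.compl

theorem cdf_map (hf : Measurable f) (b : ℝ) : cdf (P.map f) b = P.real {ω | f ω ≤ b} := by
  have := Measure.isProbabilityMeasure_map (μ := P) hf.aemeasurable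
  rw [cdf_eq_real, map_measureReal_apply hf measurableSet_Iic]
  rfl

theorem real_notMem_Iic (hf : Measurable f) (b : ℝ) :
    P.real {ω | f ω ∉ Set.Iic b} = 1 - cdf (P.map f) b := by
  rw [cdf_map hf]
  exact probReal_compl_eq_one_sub (μ := P) (hf (measurableSet_Iic (a := b)))

theorem real_notMem_Iic_pos (hf : Measurable f) {b : ℝ} (hb : cdf (P.map f) b < 1) :
    0 < P.real {ω | f ω ∉ Set.Iic b} := by
  rw [real_notMem_Iic hf]
  exact sub_pos.2 hb

end Law

namespace IsRandomCensorship

variable {Ω E : Type*} [MeasurableSpace Ω] [MeasurableSpace E] {P : Measure Ω}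
  {T : ℕ → Ω → ℝ} {X : ℕ → Ω → E} {C : ℕ → Ω → ℝ} {L L' : Set ℝ}

theorem real_min_notMem (h : IsRandomCensorship P T X C) (hL : IsLowerSet L)
    (hm : MeasurableSet L) :
    P.real {ω | min (T 0 ω) (C 0 ω) ∉ L} =
      P.real {ω | T 0 ω ∉ L} * P.real {ω | C 0 ω ∉ L} := by
  refine Eq.trans ?_ (h.real_and_censoring (A := Lᶜ) (B := Lᶜ) hm.compl hm.compl)
  simp only [min_mem_iff_of_isLowerSet hL, not_or, Set.mem_compl_iff]

variable [IsProbabilityMeasure P]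

/-- The probability of an uncensored value between `L` and `L'` is squeezed between products:
a censoring time beyond `L'` allows it, a censoring time in `L` forbids it. -/
theorem real_uncensored_mem_diff (h : IsRandomCensorship P T X C) (hL : IsLowerSet L)
    (hL' : IsLowerSet L') (hLL : L ⊆ L') (hm : MeasurableSet L) (hm' : MeasurableSet L') :
    P.real {ω | C 0 ω ∉ L'} * (P.real {ω | T 0 ω ∉ L} - P.real {ω | T 0 ω ∉ L'}) ≤
        P.real {ω | T 0 ω ≤ C 0 ω ∧ min (T 0 ω) (C 0 ω) ∈ L' \ L} ∧
      P.real {ω | T 0 ω ≤ C 0 ω ∧ min (T 0 ω) (C 0 ω) ∈ L' \ L} ≤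
        P.real {ω | C 0 ω ∉ L} * (P.real {ω | T 0 ω ∉ L} - P.real {ω | T 0 ω ∉ L'}) := by
  rw [← real_mem_diff (h.measurable_T 0) hLL hm', mul_comm,
    mul_comm (P.real {ω | C 0 ω ∉ L})]
  have h1 := h.real_and_censoring (A := L' \ L) (B := L'ᶜ) (hm'.diff hm) hm'.compl
  have h2 := h.real_and_censoring (A := L' \ L) (B := Lᶜ) (hm'.diff hm) hm.compl
  simp only [Set.mem_compl_iff] at h1 h2
  rw [← h1, ← h2]
  constructor
  · refine measureReal_mono fun ω hω => ?_
    obtain ⟨h3, h4⟩ := hω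
    have h5 : T 0 ω ≤ C 0 ω := by
      by_contra hc
      exact h4 (hL' (not_le.1 hc).le h3.1)
    exact ⟨h5, by rwa [min_eq_left h5]⟩
  · refine measureReal_mono fun ω hω => ?_
    obtain ⟨h3, h4⟩ := hω
    rw [min_eq_left h3] at h4
    exact ⟨h4, fun hc => h4.2 (hL h3 hc)⟩

/-- Somebody at risk after `L` has an uncensored value between `L` and `L'`, is still at risk after
`L'`, or is censored in between. -/
theorem real_min_notMem_eq_add (h : IsRandomCensorship P T X C)
    (hLL : L ⊆ L') (hm : MeasurableSet L) (hm' : MeasurableSet L') :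
    P.real {ω | min (T 0 ω) (C 0 ω) ∉ L} =
      P.real {ω | T 0 ω ≤ C 0 ω ∧ min (T 0 ω) (C 0 ω) ∈ L' \ L} +
      P.real {ω | min (T 0 ω) (C 0 ω) ∉ L'} +
      P.real {ω | ¬ T 0 ω ≤ C 0 ω ∧ min (T 0 ω) (C 0 ω) ∈ L' \ L} := by
  have hmin : Measurable fun ω => min (T 0 ω) (C 0 ω) :=
    (h.measurable_T 0).min (h.measurable_C 0)
  have hcell : MeasurableSet {ω | min (T 0 ω) (C 0 ω) ∈ L' \ L} := hmin (hm'.diff hm)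
  have hbeyond : MeasurableSet {ω | min (T 0 ω) (C 0 ω) ∉ L'} := hmin hm'.compl
  rw [← measureReal_union, ← measureReal_union]
  · congr 1
    ext ω
    have := @hLL (min (T 0 ω) (C 0 ω))
    simp only [Set.mem_ofPred_eq, Set.mem_union, Set.mem_sdiff]
    tauto
  · rw [Set.disjoint_left]
    rintro ω (h1 | h1) h2
    · exact h2.1 h1.1
    · exact h1 h2.2.1
  · exact (measurableSet_le (h.measurable_T 0) (h.measurable_C 0)).compl.inter hcell
  · rw [Set.disjoint_left]
    exact fun ω h1 h2 => h2 h1.2.1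
  · exact hbeyond

theorem real_censored_mem_diff_le :
    P.real {ω | ¬ T 0 ω ≤ C 0 ω ∧ min (T 0 ω) (C 0 ω) ∈ L' \ L} ≤
      P.real {ω | C 0 ω ∈ L' \ L} := by
  refine measureReal_mono fun ω hω => ?_
  obtain ⟨h1, h2⟩ := hω
  rwa [min_eq_right (not_le.1 h1).le] at h2

end IsRandomCensorship

/-- The limits of the bounds for the Kaplan–Meier estimator on one cell. Here `S, S'` and `K, K'`
are the survival functions of the values and of the censoring times at the ends of the cell, and
`p` and `g` are the probabilities of an uncensored and of a censored observation in it. -/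
theorem cell_bounds {S S' K K' p g θ : ℝ} (hθ : 0 < θ) (hS'0 : 0 ≤ S') (hS : S' ≤ S)
    (hp0 : 0 ≤ p) (hg0 : 0 ≤ g)
    (hθS : θ ≤ S' * K') (hp : K' * (S - S') ≤ p) (hp' : p ≤ K * (S - S'))
    (h : S * K = p + S' * K' + g) :
    S * (S' * K' / (p + S' * K')) ≤ S' ∧ S' ≤ S * (1 - p / (S * K)) ∧
    0 ≤ S' * K' / (p + S' * K') ∧ S' * K' / (p + S' * K') ≤ 1 - p / (S * K) ∧
      1 - p / (S * K) ≤ 1 ∧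
      1 - p / (S * K) - S' * K' / (p + S' * K') ≤ p * g / θ ^ 2 := by
  have h1 : 0 < S' * K' := hθ.trans_le hθS
  have h2 : 0 < p + S' * K' := by linarith
  have h3 : 0 < S * K := by linarith
  have hS0 : 0 < S := lt_of_le_of_ne (hS'0.trans hS) (by rintro rfl; simp at h3)
  have hK0 : 0 < K := by
    by_contra hc
    nlinarith [not_lt.1 hc]
  have hsub : 1 - p / (S * K) - S' * K' / (p + S' * K') = p * g / ((p + S' * K') * (S * K)) := by
    have : g = S * K - p - S' * K' := by linarith
    rw [this]
    field_simp
    ring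
  refine ⟨?_, ?_, by positivity, ?_, ?_, ?_⟩
  · rw [← mul_div_assoc, div_le_iff₀ h2]
    nlinarith
  · have : S * (1 - p / (S * K)) = S - p / K := by
      field_simp
    rw [this]
    have : p / K ≤ S - S' := by
      rw [div_le_iff₀ hK0]
      linarith
    linarith
  · rw [← sub_nonneg, hsub]
    positivity
  · have : 0 ≤ p / (S * K) := by positivity
    linarith
  · rw [hsub]
    gcongr
    nlinarith

namespace IsRandomCensorship

variable {Ω E : Type*} [MeasurableSpace Ω] [MeasurableSpace E] {P : Measure Ω}
  [IsProbabilityMeasure P]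
  {T : ℕ → Ω → ℝ} {X : ℕ → Ω → E} {C : ℕ → Ω → ℝ}

theorem ae_tendsto_freq_uncensored (h : IsRandomCensorship P T X C) {L : Set ℝ}
    (hm : MeasurableSet L) :
    ∀ᵐ ω ∂P, Tendsto (fun n => freq n (fun i => T i ω ≤ C i ω ∧ min (T i ω) (C i ω) ∈ L)) atTop
      (𝓝 (P.real {ω | T 0 ω ≤ C 0 ω ∧ min (T 0 ω) (C 0 ω) ∈ L})) := by
  have hA : MeasurableSet {z : ℝ × E × ℝ | z.1 ≤ z.2.2 ∧ min z.1 z.2.2 ∈ L} :=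
    MeasurableSet.inter (s₁ := {z : ℝ × E × ℝ | z.1 ≤ z.2.2})
      (measurableSet_le (by fun_prop) (by fun_prop))
      ((by fun_prop : Measurable fun z : ℝ × E × ℝ => min z.1 z.2.2) hm)
  exact h.ae_tendsto_freq (A := {z : ℝ × E × ℝ | z.1 ≤ z.2.2 ∧ min z.1 z.2.2 ∈ L}) hA

theorem ae_tendsto_freq_min (h : IsRandomCensorship P T X C) {L : Set ℝ}
    (hm : MeasurableSet L) :
    ∀ᵐ ω ∂P, Tendsto (fun n => freq n (fun i => min (T i ω) (C i ω) ∉ L)) atTop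
      (𝓝 (P.real {ω | min (T 0 ω) (C 0 ω) ∉ L})) :=
  h.ae_tendsto_freq (A := {z : ℝ × E × ℝ | min z.1 z.2.2 ∉ L})
    ((by fun_prop : Measurable fun z : ℝ × E × ℝ => min z.1 z.2.2) hm.compl)

/-- Strong consistency of the Kaplan–Meier estimator at a point `t` that neither the values nor
the censoring times almost surely stay below, if these have no common atom. -/
theorem ae_tendsto_kmProd (h : IsRandomCensorship P T X C)
    (hat : ∀ s, P.map (T 0) {s} = 0 ∨ P.map (C 0) {s} = 0) {t : ℝ}
    (hT : 0 < P.real {ω | T 0 ω ∉ Set.Iic t}) (hC : 0 < P.real {ω | C 0 ω ∉ Set.Iic t}) :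
    ∀ᵐ ω ∂P, Tendsto (fun n => kmProd n (fun i => min (T i ω) (C i ω))
      (fun i => T i ω ≤ C i ω) (Set.Iic t)) atTop (𝓝 (P.real {ω | T 0 ω ∉ Set.Iic t})) := by
  set θ : ℝ := P.real {ω | T 0 ω ∉ Set.Iic t} * P.real {ω | C 0 ω ∉ Set.Iic t} with hθ
  have hθ0 : 0 < θ := mul_pos hT hC
  have := Measure.isProbabilityMeasure_map (μ := P) (h.measurable_T 0).aemeasurable
  have := Measure.isProbabilityMeasure_map (μ := P) (h.measurable_C 0).aemeasurable
  -- countably many chains, chosen before the sample path, so that one null set serves for all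
  have hchain : ∀ N : ℕ, ∃ m L, IsLowerChain t m L ∧ ∑ k ∈ Finset.range m,
      (P.map (T 0)).real (L (k + 1) \ L k) * (P.map (C 0)).real (L (k + 1) \ L k) ≤
        θ ^ 2 * (1 / ((N : ℝ) + 1)) := fun N =>
    exists_isLowerChain _ _ hat t (by positivity)
  choose m L hL hsum using hchain
  have h1 : ∀ᵐ ω ∂P, ∀ N k, Tendsto (fun n => freq n (fun i => T i ω ≤ C i ω ∧
      min (T i ω) (C i ω) ∈ L N (k + 1) \ L N k)) atTop
      (𝓝 (P.real {ω | T 0 ω ≤ C 0 ω ∧ min (T 0 ω) (C 0 ω) ∈ L N (k + 1) \ L N k})) :=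
    ae_all_iff.2 fun N => ae_all_iff.2 fun k => h.ae_tendsto_freq_uncensored
      (((hL N).measurableSet _).diff ((hL N).measurableSet _))
  have h2 : ∀ᵐ ω ∂P, ∀ N k, Tendsto (fun n => freq n (fun i => min (T i ω) (C i ω) ∉ L N k)) atTop
      (𝓝 (P.real {ω | min (T 0 ω) (C 0 ω) ∉ L N k})) :=
    ae_all_iff.2 fun N => ae_all_iff.2 fun k => h.ae_tendsto_freq_min ((hL N).measurableSet _)
  filter_upwards [h1, h2] with ω h1 h2
  refine tendsto_of_forall_sandwich fun ε hε => ?_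
  obtain ⟨N, hN⟩ := exists_nat_one_div_lt hε
  replace h1 := h1 N
  replace h2 := h2 N
  replace hsum := hsum N
  replace hL := hL N
  generalize m N = m at hsum hL
  generalize L N = L at h1 h2 hsum hL
  set S : ℕ → ℝ := fun k => P.real {ω | T 0 ω ∉ L k} with hS
  set K : ℕ → ℝ := fun k => P.real {ω | C 0 ω ∉ L k} with hK
  set p : ℕ → ℝ := fun k =>
    P.real {ω | T 0 ω ≤ C 0 ω ∧ min (T 0 ω) (C 0 ω) ∈ L (k + 1) \ L k} with hp
  set g : ℕ → ℝ := fun k =>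
    P.real {ω | ¬ T 0 ω ≤ C 0 ω ∧ min (T 0 ω) (C 0 ω) ∈ L (k + 1) \ L k} with hg
  have hSK : ∀ k, P.real {ω | min (T 0 ω) (C 0 ω) ∉ L k} = S k * K k := fun k =>
    h.real_min_notMem (hL.isLowerSet k) (hL.measurableSet k)
  simp only [hSK] at h2
  have hsub : ∀ k ≤ m, L k ⊆ Set.Iic t := fun k hk => hL.last ▸ hL.mono hk
  have hθk : ∀ k ≤ m, θ ≤ S k * K k := fun k hk => by
    refine mul_le_mul (measureReal_mono fun ω hω hc => hω (hsub k hk hc))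
      (measureReal_mono fun ω hω hc => hω (hsub k hk hc)) measureReal_nonneg measureReal_nonneg
  have hcell : ∀ k < m, _ := fun k hk =>
    cell_bounds (S := S k) (S' := S (k + 1)) (K := K k) (K' := K (k + 1)) (p := p k) (g := g k) hθ0
    measureReal_nonneg
    (measureReal_mono fun ω hω hc => hω (hL.mono (Nat.le_succ k) hc)) measureReal_nonneg
    measureReal_nonneg (hθk (k + 1) hk)
    (h.real_uncensored_mem_diff (hL.isLowerSet _) (hL.isLowerSet _) (hL.mono (Nat.le_succ k))
      (hL.measurableSet _) (hL.measurableSet _)).1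
    (h.real_uncensored_mem_diff (hL.isLowerSet _) (hL.isLowerSet _) (hL.mono (Nat.le_succ k))
      (hL.measurableSet _) (hL.measurableSet _)).2
    (by
      rw [← hSK, ← hSK]
      exact h.real_min_notMem_eq_add (hL.mono (Nat.le_succ k)) (hL.measurableSet _)
        (hL.measurableSet _))
  have hS0 : S 0 = 1 := by
    simp [hS, hL.zero]
  have hSm : S m = P.real {ω | T 0 ω ∉ Set.Iic t} := by simp only [hS, hL.last]
  obtain ⟨hlS, hSu⟩ := prod_bounds (s := S) (l := fun k => S (k + 1) * K (k + 1) /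
      (p k + S (k + 1) * K (k + 1))) (u := fun k => 1 - p k / (S k * K k)) m hS0
      (fun k hk => (hcell k hk).2.2.1) (fun k hk => (hcell k hk).2.2.1.trans (hcell k hk).2.2.2.1)
      (fun k hk => (hcell k hk).1) (fun k hk => (hcell k hk).2.1)
  have hgap := (prod_sub_prod_le (l := fun k => S (k + 1) * K (k + 1) /
      (p k + S (k + 1) * K (k + 1))) (u := fun k => 1 - p k / (S k * K k)) m
      (fun k hk => (hcell k hk).2.2.1) (fun k hk => (hcell k hk).2.2.2.1)
      (fun k hk => (hcell k hk).2.2.2.2.1)).trans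
      (Finset.sum_le_sum fun k hk => (hcell k (Finset.mem_range.1 hk)).2.2.2.2.2)
  have hgap' : ∑ k ∈ Finset.range m, p k * g k / θ ^ 2 ≤ ε := by
    rw [← Finset.sum_div, div_le_iff₀ (by positivity)]
    refine (Finset.sum_le_sum fun k _ => ?_).trans (hsum.trans (by
      rw [mul_comm]
      gcongr))
    rw [map_measureReal_apply (h.measurable_T 0)
      ((hL.measurableSet _).diff (hL.measurableSet _)), map_measureReal_apply (h.measurable_C 0)
      ((hL.measurableSet _).diff (hL.measurableSet _))]
    refine mul_le_mul (measureReal_mono fun ω hω => ?_) real_censored_mem_diff_le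
      measureReal_nonneg measureReal_nonneg
    have h3 := hω.2
    rw [min_eq_left hω.1] at h3
    exact h3
  have hb : ∀ n, _ := fun n => prod_bounds (s := fun k => kmProd n (fun i => min (T i ω) (C i ω))
      (fun i => T i ω ≤ C i ω) (L k)) m (by simp only [hL.zero, kmProd_empty])
    (fun k _ => div_nonneg (freq_nonneg _) (add_nonneg (freq_nonneg _) (freq_nonneg _)))
    (fun k _ => by
      refine sub_nonneg.2 (div_le_one_of_le₀ ?_ (freq_nonneg _))
      refine div_le_div_of_nonneg_right ?_ (Nat.cast_nonneg _)
      exact Nat.cast_le.2 (countBelow_mono fun i _ (hi : _ ∧ _ ∧ _) => hi.2.2))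
    (fun k _ => mul_le_kmProd (hL.isLowerSet _) (hL.mono (Nat.le_succ k)))
    (fun k _ => kmProd_le_mul (hL.isLowerSet _) (hL.mono (Nat.le_succ k)))
  refine ⟨_, _, ∏ k ∈ Finset.range m, S (k + 1) * K (k + 1) / (p k + S (k + 1) * K (k + 1)),
    ∏ k ∈ Finset.range m, (1 - p k / (S k * K k)), ?_, ?_,
    Eventually.of_forall fun n => hL.last ▸ (hb n).1,
    Eventually.of_forall fun n => hL.last ▸ (hb n).2, ?_, ?_⟩
  · refine tendsto_finsetProd _ fun k hk => (h2 (k + 1)).div ((h1 k).add (h2 (k + 1))) ?_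
    have hk := hθk (k + 1) (Finset.mem_range.1 hk)
    have : 0 ≤ p k := measureReal_nonneg
    exact ne_of_gt (add_pos_of_nonneg_of_pos this (hθ0.trans_le hk))
  · refine tendsto_finsetProd _ fun k hk => ((h1 k).div (h2 k) ?_).const_sub 1
    exact ne_of_gt (hθ0.trans_le (hθk k (Finset.mem_range.1 hk).le))
  · rw [← hSm]
    simp only [hp] at hgap hgap' hlS hSu ⊢
    linarith
  · rw [← hSm]
    simp only [hp] at hgap hgap' hlS hSu ⊢
    linarith

end IsRandomCensorship

/-! ### Convergence before the end points -/

section Deterministic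

variable {n : ℕ} {r : ℕ → ℝ} {δ q : ℕ → Prop} {a : ℝ} {m : ℕ} {L : ℕ → Set ℝ}

open Classical in
theorem sum_cells_div (c : ℕ → ℝ) :
    (∑ i ∈ (Finset.range n).filter q, ∑ k ∈ Finset.range m,
      if r i ∈ L (k + 1) \ L k then (if δ i then 1 else c k) else 0) / n =
    ∑ k ∈ Finset.range m, (freq n (fun i => q i ∧ δ i ∧ r i ∈ L (k + 1) \ L k) +
      freq n (fun i => q i ∧ ¬ δ i ∧ r i ∈ L (k + 1) \ L k) * c k) := by
  rw [Finset.sum_comm, Finset.sum_div]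
  refine Finset.sum_congr rfl fun k _ => ?_
  unfold freq countBelow
  rw [div_mul_eq_mul_div, ← add_div, Finset.sum_filter]
  congr 1
  rw [Finset.natCast_card_filter, Finset.natCast_card_filter, Finset.sum_mul,
    ← Finset.sum_add_distrib]
  refine Finset.sum_congr rfl fun i _ => ?_
  by_cases h1 : q i <;> by_cases h2 : δ i <;> by_cases h3 : r i ∈ L (k + 1) \ L k <;>
    simp [h1, h2, h3]

open Classical in
theorem sum_cells_eq (hL : IsLowerChain a m L) (f : ℕ → ℝ) {s : ℝ} {k : ℕ} (hk : k < m)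
    (hs : s ∈ L (k + 1) \ L k) :
    ∑ k ∈ Finset.range m, (if s ∈ L (k + 1) \ L k then f k else 0) = f k := by
  rw [Finset.sum_eq_single k]
  · exact if_pos hs
  · exact fun j _ hj => if_neg fun h => hj (hL.eq_of_mem_diff h hs)
  · exact fun h => absurd (Finset.mem_range.2 hk) h

open Classical in
theorem sum_cells_eq_zero (hL : IsLowerChain a m L) (f : ℕ → ℝ) {s : ℝ} (hs : a < s) :
    ∑ k ∈ Finset.range m, (if s ∈ L (k + 1) \ L k then f k else 0) = 0 := by
  refine Finset.sum_eq_zero fun k hk => if_neg fun h => ?_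
  have : s ∈ L m := hL.mono (Finset.mem_range.1 hk) h.1
  rw [hL.last] at this
  exact absurd hs (not_lt.2 this)

/-- The condition `he` excludes a vanishing denominator. -/
theorem massBelow_eq {i : ℕ} (he : kmProd n r δ Set.univ < kmProd n r δ (Set.Iic a))
    (hi : r i ≤ a) (hδ : ¬ δ i) : massBelow n r δ a i =
      1 - (kmProd n r δ (Set.Iic a) - kmProd n r δ Set.univ) /
        (kmProd n r δ (Set.Iic (r i)) - kmProd n r δ Set.univ) := by
  have : kmProd n r δ (Set.Iic a) ≤ kmProd n r δ (Set.Iic (r i)) :=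
    kmProd_anti (Set.Iic_subset_Iic.2 hi)
  rw [massBelow, if_pos hi, if_neg hδ, one_sub_div (by linarith)]
  congr 1
  ring

/-- A censored observation in the cell `L (k + 1) \ L k` is treated as if it were at the end of
the cell (lower bound) or at its beginning (upper bound). -/
theorem massFreq_bounds (hL : IsLowerChain a m L)
    (he : kmProd n r δ Set.univ < kmProd n r δ (Set.Iic a)) :
    ∑ k ∈ Finset.range m, (freq n (fun i => q i ∧ δ i ∧ r i ∈ L (k + 1) \ L k) +
      freq n (fun i => q i ∧ ¬ δ i ∧ r i ∈ L (k + 1) \ L k) *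
        (1 - (kmProd n r δ (Set.Iic a) - kmProd n r δ Set.univ) /
          (kmProd n r δ (L (k + 1)) - kmProd n r δ Set.univ))) ≤
      massFreq n r δ a q ∧
    massFreq n r δ a q ≤
      ∑ k ∈ Finset.range m, (freq n (fun i => q i ∧ δ i ∧ r i ∈ L (k + 1) \ L k) +
      freq n (fun i => q i ∧ ¬ δ i ∧ r i ∈ L (k + 1) \ L k) *
        (1 - (kmProd n r δ (Set.Iic a) - kmProd n r δ Set.univ) /
          (kmProd n r δ (L k) - kmProd n r δ Set.univ))) := by
  classical
  unfold massFreq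
  rw [← sum_cells_div, ← sum_cells_div]
  have hcell : ∀ {i k}, k < m → r i ∈ L (k + 1) \ L k →
      kmProd n r δ (Set.Iic a) ≤ kmProd n r δ (L (k + 1)) ∧
      kmProd n r δ (L (k + 1)) ≤ kmProd n r δ (Set.Iic (r i)) ∧
      kmProd n r δ (Set.Iic (r i)) ≤ kmProd n r δ (L k) := by
    intro i k hk hi
    refine ⟨kmProd_anti (hL.last ▸ hL.mono hk), kmProd_anti fun s hs =>
      hL.isLowerSet _ hs hi.1, kmProd_anti fun s hs => ?_⟩
    by_contra h
    exact hi.2 (hL.isLowerSet k (not_le.1 h).le hs)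
  constructor
  · refine div_le_div_of_nonneg_right (Finset.sum_le_sum fun i _ => ?_) (Nat.cast_nonneg _)
    rcases le_or_gt (r i) a with hi | hi
    · obtain ⟨k, hk, hs⟩ := hL.exists_mem_diff hi
      rw [sum_cells_eq hL _ hk hs]
      split_ifs with hδ
      · rw [massBelow, if_pos hi, if_pos hδ]
      · rw [massBelow_eq he hi hδ]
        obtain ⟨h1, h2, h3⟩ := hcell hk hs
        exact sub_le_sub_left (div_le_div_of_nonneg_left (by linarith) (by linarith)
          (by linarith)) _
    · rw [sum_cells_eq_zero hL _ hi]
      exact massBelow_nonneg _ _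
  · refine div_le_div_of_nonneg_right (Finset.sum_le_sum fun i _ => ?_) (Nat.cast_nonneg _)
    rcases le_or_gt (r i) a with hi | hi
    · obtain ⟨k, hk, hs⟩ := hL.exists_mem_diff hi
      rw [sum_cells_eq hL _ hk hs]
      split_ifs with hδ
      · rw [massBelow, if_pos hi, if_pos hδ]
      · rw [massBelow_eq he hi hδ]
        obtain ⟨h1, h2, h3⟩ := hcell hk hs
        exact sub_le_sub_left (div_le_div_of_nonneg_left (by linarith) (by linarith)
          (by linarith)) _
    · rw [sum_cells_eq_zero hL _ hi, massBelow, if_neg (not_le.2 hi)]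

end Deterministic

/-- The error made on one cell by the bounds of `massFreq_bounds` in the limit. Here `S, S'` and
`Sm` are the survival functions of the values at the ends of the cell and at `a`, and `w` and `g`
are the probabilities that the censoring time lies in the cell, and that it does so and censors. -/
theorem cell_gap {S S' Sm w g : ℝ} (hSm : 0 < Sm) (h1 : Sm ≤ S') (h2 : S' ≤ S) (hw : 0 ≤ w)
    (hg : w * S' ≤ g) (hg' : g ≤ w * S) :
    g * (1 - Sm / S) ≤ g - Sm * w + (S - S') * w ∧
      g - Sm * w - (S - S') * w ≤ g * (1 - Sm / S') := by
  have hS' : 0 < S' := hSm.trans_le h1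
  have hS : 0 < S := hS'.trans_le h2
  constructor
  · have h3 : Sm * w - (S - S') * w ≤ g * Sm / S := by
      rw [le_div_iff₀ hS]
      nlinarith [mul_le_mul_of_nonneg_right hg hSm.le,
        mul_nonneg (mul_nonneg (sub_nonneg.2 h2) hw) (sub_nonneg.2 (h1.trans h2))]
    have h4 : g * (1 - Sm / S) = g - g * Sm / S := by ring
    linarith
  · have h3 : g * Sm / S' ≤ Sm * w + (S - S') * w := by
      rw [div_le_iff₀ hS']
      nlinarith [mul_le_mul_of_nonneg_right hg' hSm.le,
        mul_nonneg (mul_nonneg (sub_nonneg.2 h2) hw) (sub_nonneg.2 h1)]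
    have h4 : g * (1 - Sm / S') = g - g * Sm / S' := by ring
    linarith

namespace IsRandomCensorship

variable {Ω E : Type*} [MeasurableSpace Ω] [MeasurableSpace E] {P : Measure Ω}
  [IsProbabilityMeasure P]
  {T : ℕ → Ω → ℝ} {X : ℕ → Ω → E} {C : ℕ → Ω → ℝ}

theorem sum_real_mem_cell {a : ℝ} {m : ℕ} {L : ℕ → Set ℝ} (hL : IsLowerChain a m L)
    {B : Set Ω} (hB : MeasurableSet B) {f : Ω → ℝ} (hf : Measurable f) :
    ∑ k ∈ Finset.range m, P.real {ω | ω ∈ B ∧ f ω ∈ L (k + 1) \ L k} =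
      P.real {ω | ω ∈ B ∧ f ω ≤ a} := by
  have key : ∀ j, ∑ k ∈ Finset.range j, P.real {ω | ω ∈ B ∧ f ω ∈ L (k + 1) \ L k} =
      P.real {ω | ω ∈ B ∧ f ω ∈ L j} := by
    intro j
    induction j with
    | zero => simp [hL.zero]
    | succ j ih =>
      rw [Finset.sum_range_succ, ih, ← measureReal_union]
      · congr 1
        ext ω
        have := @hL.mono j (j + 1) (Nat.le_succ j) (f ω)
        simp only [Set.mem_ofPred_eq, Set.mem_union, Set.mem_sdiff]
        tauto
      · rw [Set.disjoint_left]
        exact fun ω h1 h2 => h2.2.2 h1.2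
      · exact hB.inter (hf ((hL.measurableSet _).diff (hL.measurableSet _)))
  rw [key, hL.last]
  rfl

/-- The limit law splits over the cells of a chain: the uncensored mass, plus the censored mass
that is not moved beyond `a`. -/
theorem real_mul_real_eq_sum (h : IsRandomCensorship P T X C) {a : ℝ} {m : ℕ}
    {L : ℕ → Set ℝ} (hL : IsLowerChain a m L) {V : Set E} (hV : MeasurableSet V) :
    P.real {ω | T 0 ω ≤ a} * P.real {ω | X 0 ω ∈ V} = ∑ k ∈ Finset.range m,
      (P.real {ω | X 0 ω ∈ V ∧ T 0 ω ≤ C 0 ω ∧ min (T 0 ω) (C 0 ω) ∈ L (k + 1) \ L k} +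
        (P.real {ω | X 0 ω ∈ V ∧ ¬ T 0 ω ≤ C 0 ω ∧ min (T 0 ω) (C 0 ω) ∈ L (k + 1) \ L k} -
        P.real {ω | T 0 ω ∉ Set.Iic a} * P.real {ω | X 0 ω ∈ V ∧ C 0 ω ∈ L (k + 1) \ L k})) := by
  have hT := h.measurable_T 0
  have hC := h.measurable_C 0
  have hXV : MeasurableSet {ω | X 0 ω ∈ V} := h.measurable_X 0 hV
  have hTC : MeasurableSet {ω | T 0 ω ≤ C 0 ω} := measurableSet_le hT hC
  have hmin : Measurable fun ω => min (T 0 ω) (C 0 ω) := hT.min hC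
  have h1 := sum_real_mem_cell (P := P) hL (hXV.inter hTC) hmin
  have h2 := sum_real_mem_cell (P := P) hL (hXV.inter hTC.compl) hmin
  have h3 := sum_real_mem_cell (P := P) hL hXV hC
  have h4 := h.real_and (A := (Set.Iic a)ᶜ) (B := V ×ˢ Set.Iic a) measurableSet_Iic.compl
    (hV.prod measurableSet_Iic)
  have h5 := h.real_and (A := Set.Iic a) (B := V ×ˢ Set.univ) measurableSet_Iic
    (hV.prod MeasurableSet.univ)
  simp only [Set.mem_inter_iff, Set.mem_ofPred_eq, Set.mem_compl_iff, and_assoc] at h1 h2 h3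
  simp only [Set.mem_compl_iff, Set.mem_prod, Set.mem_univ, and_true] at h4 h5
  rw [Finset.sum_add_distrib, Finset.sum_sub_distrib, ← Finset.mul_sum, h1, h2, h3]
  refine Eq.trans h5.symm ?_
  rw [add_sub, eq_sub_iff_add_eq]
  refine (congrArg _ h4.symm).trans ?_
  rw [← measureReal_union, ← measureReal_union]
  · congr 1
    ext ω
    simp only [Set.mem_ofPred_eq, Set.mem_union, Set.mem_Iic, min_le_iff]
    tauto
  · rw [Set.disjoint_left]
    exact fun ω h1 h2 => h2.2.1 h1.2.1
  · exact hXV.inter (hTC.compl.inter (hmin measurableSet_Iic))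
  · rw [Set.disjoint_left]
    exact fun ω h1 h2 => h2.1 h1.1
  · exact (hT measurableSet_Iic.compl).inter (hXV.inter (hC measurableSet_Iic))

/-- For a censoring time in the cell, the value exceeds it if it lies beyond the cell, and only if
it does not lie before the cell. -/
theorem real_censored_mem_diff (h : IsRandomCensorship P T X C) {L L' : Set ℝ}
    (hL : IsLowerSet L) (hL' : IsLowerSet L') (hm : MeasurableSet L) (hm' : MeasurableSet L')
    {V : Set E} (hV : MeasurableSet V) :
    P.real {ω | X 0 ω ∈ V ∧ C 0 ω ∈ L' \ L} * P.real {ω | T 0 ω ∉ L'} ≤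
        P.real {ω | X 0 ω ∈ V ∧ ¬ T 0 ω ≤ C 0 ω ∧ min (T 0 ω) (C 0 ω) ∈ L' \ L} ∧
      P.real {ω | X 0 ω ∈ V ∧ ¬ T 0 ω ≤ C 0 ω ∧ min (T 0 ω) (C 0 ω) ∈ L' \ L} ≤
        P.real {ω | X 0 ω ∈ V ∧ C 0 ω ∈ L' \ L} * P.real {ω | T 0 ω ∉ L} := by
  have h1 := h.real_and (A := L'ᶜ) (B := V ×ˢ (L' \ L)) hm'.compl (hV.prod (hm'.diff hm))
  have h2 := h.real_and (A := Lᶜ) (B := V ×ˢ (L' \ L)) hm.compl (hV.prod (hm'.diff hm))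
  constructor
  · refine ((mul_comm _ _).trans h1.symm).le.trans (measureReal_mono fun ω hω => ?_)
    obtain ⟨h3, h4, h5⟩ := hω
    have h6 : ¬ T 0 ω ≤ C 0 ω := fun h6 => h3 (hL' h6 h5.1)
    exact ⟨h4, h6, by rwa [min_eq_right (not_le.1 h6).le]⟩
  · refine (measureReal_mono fun ω hω => ?_).trans (h2.trans (mul_comm _ _)).le
    obtain ⟨h3, h4, h5⟩ := hω
    rw [min_eq_right (not_le.1 h4).le] at h5
    exact ⟨fun hT => h5.2 (hL (not_le.1 h4).le hT), h3, h5⟩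

theorem ae_tendsto_freq_and (h : IsRandomCensorship P T X C) {L : Set ℝ}
    (hm : MeasurableSet L) {V : Set E} (hV : MeasurableSet V) :
    ∀ᵐ ω ∂P, Tendsto (fun n => freq n
        (fun i => X i ω ∈ V ∧ T i ω ≤ C i ω ∧ min (T i ω) (C i ω) ∈ L)) atTop
        (𝓝 (P.real {ω | X 0 ω ∈ V ∧ T 0 ω ≤ C 0 ω ∧ min (T 0 ω) (C 0 ω) ∈ L})) ∧
      Tendsto (fun n => freq n
        (fun i => X i ω ∈ V ∧ ¬ T i ω ≤ C i ω ∧ min (T i ω) (C i ω) ∈ L)) atTop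
        (𝓝 (P.real {ω | X 0 ω ∈ V ∧ ¬ T 0 ω ≤ C 0 ω ∧ min (T 0 ω) (C 0 ω) ∈ L})) := by
  have h1 : MeasurableSet {z : ℝ × E × ℝ | z.1 ≤ z.2.2} :=
    measurableSet_le (by fun_prop) (by fun_prop)
  have h2 : MeasurableSet {z : ℝ × E × ℝ | min z.1 z.2.2 ∈ L} :=
    (by fun_prop : Measurable fun z : ℝ × E × ℝ => min z.1 z.2.2) hm
  have h3 : MeasurableSet {z : ℝ × E × ℝ | z.2.1 ∈ V} :=
    (by fun_prop : Measurable fun z : ℝ × E × ℝ => z.2.1) hV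
  filter_upwards [h.ae_tendsto_freq
      (A := {z : ℝ × E × ℝ | z.2.1 ∈ V ∧ z.1 ≤ z.2.2 ∧ min z.1 z.2.2 ∈ L}) (h3.inter (h1.inter h2)),
    h.ae_tendsto_freq
      (A := {z : ℝ × E × ℝ | z.2.1 ∈ V ∧ ¬ z.1 ≤ z.2.2 ∧ min z.1 z.2.2 ∈ L})
      (h3.inter (h1.compl.inter h2))] with ω h4 h5
  exact ⟨h4, h5⟩

/-- Convergence of the redistributed mass at a point `a` before the end points of both
distributions, if the defect of the Kaplan–Meier estimator vanishes in the limit. -/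
theorem ae_tendsto_massFreq_of_lt (h : IsRandomCensorship P T X C)
    (hat : ∀ s, P.map (T 0) {s} = 0 ∨ P.map (C 0) {s} = 0) {a : ℝ}
    (hT : 0 < P.real {ω | T 0 ω ∉ Set.Iic a}) (hC : 0 < P.real {ω | C 0 ω ∉ Set.Iic a})
    (hdef : ∀ᵐ ω ∂P, Tendsto (fun n => kmProd n (fun i => min (T i ω) (C i ω))
      (fun i => T i ω ≤ C i ω) Set.univ) atTop (𝓝 0))
    {V : Set E} (hV : MeasurableSet V) :
    ∀ᵐ ω ∂P, Tendsto (fun n : ℕ => massFreq n (fun i => min (T i ω) (C i ω))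
      (fun i => T i ω ≤ C i ω) a (fun i => X i ω ∈ V)) atTop
      (𝓝 (P.real {ω | T 0 ω ≤ a} * P.real {ω | X 0 ω ∈ V})) := by
  have := Measure.isProbabilityMeasure_map (μ := P) (h.measurable_T 0).aemeasurable
  have := Measure.isProbabilityMeasure_map (μ := P) (h.measurable_C 0).aemeasurable
  -- countably many chains, chosen before the sample path, so that one null set serves for all
  have hchain : ∀ N : ℕ, ∃ m L, IsLowerChain a m L ∧ ∑ k ∈ Finset.range m,
      (P.map (T 0)).real (L (k + 1) \ L k) * (P.map (C 0)).real (L (k + 1) \ L k) ≤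
        1 / ((N : ℝ) + 1) := fun N => exists_isLowerChain _ _ hat a (by positivity)
  choose m L hL hsum using hchain
  have h1 : ∀ᵐ ω ∂P, ∀ N k, _ := ae_all_iff.2 fun N => ae_all_iff.2 fun k =>
    h.ae_tendsto_freq_and (((hL N).measurableSet (k + 1)).diff ((hL N).measurableSet k)) hV
  have h2 : ∀ᵐ ω ∂P, ∀ N k, k ≤ m N → Tendsto (fun n => kmProd n
      (fun i => min (T i ω) (C i ω)) (fun i => T i ω ≤ C i ω) (L N k)) atTop
      (𝓝 (P.real {ω | T 0 ω ∉ L N k})) := by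
    refine ae_all_iff.2 fun N => ae_all_iff.2 fun k => ?_
    rcases k with _ | k
    · refine Eventually.of_forall fun ω _ => ?_
      simp [(hL N).zero, kmProd_empty]
    · obtain ⟨t, ht⟩ := (hL N).exists_eq_Iic k
      by_cases hk : k + 1 ≤ m N
      · have hta : Set.Iic t ⊆ Set.Iic a := ht ▸ (hL N).last ▸ (hL N).mono hk
        have := h.ae_tendsto_kmProd hat (t := t)
          (hT.trans_le (measureReal_mono fun ω hω hc => hω (hta hc)))
          (hC.trans_le (measureReal_mono fun ω hω hc => hω (hta hc)))
        filter_upwards [this] with ω hω _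
        rw [ht]
        exact hω
      · exact Eventually.of_forall fun ω hk' => absurd hk' hk
  filter_upwards [h1, h2, hdef] with ω h1 h2 hdef
  refine tendsto_of_forall_sandwich fun ε hε => ?_
  obtain ⟨N, hN⟩ := exists_nat_one_div_lt hε
  replace h1 := h1 N
  replace h2 := h2 N
  replace hsum := hsum N
  replace hL := hL N
  generalize m N = m at hsum hL h2
  generalize L N = L at h1 h2 hsum hL
  have h2m := h2 m le_rfl
  rw [hL.last] at h2m
  have hSm : ∀ k ≤ m, P.real {ω | T 0 ω ∉ Set.Iic a} ≤ P.real {ω | T 0 ω ∉ L k} := fun k hk =>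
    measureReal_mono fun ω hω hc => hω (hL.last ▸ hL.mono hk hc)
  have hgap : ∀ k < m, _ := fun k hk => cell_gap (S := P.real {ω | T 0 ω ∉ L k}) hT (hSm (k + 1) hk)
    (measureReal_mono fun ω hω hc => hω (hL.mono (Nat.le_succ k) hc)) measureReal_nonneg
    (h.real_censored_mem_diff (hL.isLowerSet k) (hL.isLowerSet (k + 1)) (hL.measurableSet k)
      (hL.measurableSet (k + 1)) hV).1
    (h.real_censored_mem_diff (hL.isLowerSet k) (hL.isLowerSet (k + 1)) (hL.measurableSet k)
      (hL.measurableSet (k + 1)) hV).2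
  have hsum' : ∑ k ∈ Finset.range m, (P.real {ω | T 0 ω ∉ L k} - P.real {ω | T 0 ω ∉ L (k + 1)}) *
      P.real {ω | X 0 ω ∈ V ∧ C 0 ω ∈ L (k + 1) \ L k} ≤ ε := by
    refine (Finset.sum_le_sum fun k _ => ?_).trans (hsum.trans hN.le)
    rw [map_measureReal_apply (h.measurable_T 0)
      ((hL.measurableSet _).diff (hL.measurableSet _)), map_measureReal_apply (h.measurable_C 0)
      ((hL.measurableSet _).diff (hL.measurableSet _)), ← real_mem_diff (h.measurable_T 0)
      (hL.mono (Nat.le_succ k)) (hL.measurableSet _)]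
    exact mul_le_mul_of_nonneg_left (measureReal_mono fun ω hω => hω.2) measureReal_nonneg
  have hev : ∀ᶠ n in atTop, kmProd n (fun i => min (T i ω) (C i ω))
      (fun i => T i ω ≤ C i ω) Set.univ < kmProd n (fun i => min (T i ω) (C i ω))
      (fun i => T i ω ≤ C i ω) (Set.Iic a) := hdef.eventually_lt h2m hT
  have hlim : ∀ k < m, ∀ j ≤ m, _ := fun k hk j hj =>
    (h1 k).1.add ((h1 k).2.mul (((h2m.sub hdef).div ((h2 j hj).sub hdef)
      (by rw [sub_zero]; exact (hT.trans_le (hSm j hj)).ne')).const_sub 1))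
  have htarget := h.real_mul_real_eq_sum hL hV
  refine ⟨_, _, _, _,
    tendsto_finsetSum _ fun k hk => hlim k (Finset.mem_range.1 hk) (k + 1) (Finset.mem_range.1 hk),
    tendsto_finsetSum _ fun k hk => hlim k (Finset.mem_range.1 hk) k (Finset.mem_range.1 hk).le,
    hev.mono fun n hn => (massFreq_bounds hL hn).1,
    hev.mono fun n hn => (massFreq_bounds hL hn).2, ?_, ?_⟩
  · rw [htarget]
    simp only [sub_zero]
    refine (sub_le_sub_left hsum' _).trans ?_
    rw [← Finset.sum_sub_distrib]
    refine Finset.sum_le_sum fun k hk => ?_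
    have := (hgap k (Finset.mem_range.1 hk)).2
    linarith
  · rw [htarget]
    simp only [sub_zero]
    refine le_trans ?_ (add_le_add_right hsum' _)
    rw [← Finset.sum_add_distrib]
    refine Finset.sum_le_sum fun k hk => ?_
    have := (hgap k (Finset.mem_range.1 hk)).1
    linarith

end IsRandomCensorship

/-! ### Distribution functions and their end points -/

section Cdf

variable (μ : Measure ℝ)

theorem measure_singleton_eq_zero_iff [IsProbabilityMeasure μ] (s : ℝ) :
    μ {s} = 0 ↔ ContinuousAt (cdf μ) s := by
  rw [(monotone_cdf μ).continuousAt_iff_leftLim_eq_rightLim, StieltjesFunction.rightLim_eq]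
  have h : μ {s} = ENNReal.ofReal (cdf μ s - Function.leftLim (cdf μ) s) := by
    rw [← StieltjesFunction.measure_singleton, measure_cdf]
  rw [h, ENNReal.ofReal_eq_zero, sub_nonpos]
  exact ⟨fun h => le_antisymm ((monotone_cdf μ).leftLim_le le_rfl) h, fun h => h.ge⟩

/-- A finite upper end point is attained, by right continuity. -/
theorem exists_isLeast_cdf_eq_one {b : ℝ} (hb : cdf μ b = 1) :
    ∃ τ, IsLeast {t | cdf μ t = 1} τ ∧ upperEndpoint (cdf μ) = (τ : EReal) := by
  set A : Set ℝ := {t | cdf μ t = 1} with hA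
  have hmono := monotone_cdf μ
  obtain ⟨m, hm⟩ : ∃ m, cdf μ m < 1 :=
    ((tendsto_cdf_atBot μ).eventually (gt_mem_nhds zero_lt_one)).exists
  have hbdd : BddBelow A := ⟨m, fun t ht => le_of_not_gt fun h => by
    have := hmono h.le
    rw [show cdf μ t = 1 from ht] at this
    linarith⟩
  have hne : A.Nonempty := ⟨b, hb⟩
  have hgt : ∀ t, sInf A < t → cdf μ t = 1 := fun t ht => by
    obtain ⟨s, hs, hst⟩ := exists_lt_of_csInf_lt hne ht
    exact le_antisymm (cdf_le_one μ t) (by rw [← show cdf μ s = 1 from hs]; exact hmono hst.le)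
  have hτ : cdf μ (sInf A) = 1 := by
    have h1 : Tendsto (cdf μ) (𝓝[>] (sInf A)) (𝓝 (cdf μ (sInf A))) :=
      ((cdf μ).right_continuous (sInf A)).mono_left (nhdsWithin_mono _ Set.Ioi_subset_Ici_self)
    have h2 : Tendsto (cdf μ) (𝓝[>] (sInf A)) (𝓝 1) :=
      tendsto_const_nhds.congr' (eventually_nhdsWithin_of_forall fun t ht => (hgt t ht).symm)
    exact tendsto_nhds_unique h1 h2
  have hleast : IsLeast A (sInf A) := ⟨hτ, fun t ht => csInf_le hbdd ht⟩
  refine ⟨sInf A, hleast, IsLeast.csInf_eq ⟨⟨_, hτ, rfl⟩, ?_⟩⟩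
  rintro _ ⟨t, ht, rfl⟩
  exact EReal.coe_le_coe_iff.2 (hleast.2 ht)

theorem upperEndpoint_le {F : ℝ → ℝ} {b : ℝ} (hb : F b = 1) : upperEndpoint F ≤ (b : EReal) :=
  sInf_le ⟨b, hb, rfl⟩

theorem exists_cdf_eq_one_of_upperEndpoint_ne_top (h : upperEndpoint (cdf μ) ≠ ⊤) :
    ∃ b, cdf μ b = 1 := by
  by_contra! hc
  apply h
  have : {t | cdf μ t = 1} = ∅ := Set.eq_empty_iff_forall_notMem.2 hc
  rw [upperEndpoint, this, Set.image_empty, sInf_empty]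

variable {μ} {ν : Measure ℝ}

/-- The censoring distribution is not exhausted before the other one. -/
theorem ConditionR1.cdf_lt_one (h : ConditionR1 (cdf μ) (cdf ν)) {b : ℝ} (hb : cdf μ b < 1) :
    cdf ν b < 1 := by
  by_contra hc
  have hν : cdf ν b = 1 := le_antisymm (cdf_le_one ν b) (not_lt.1 hc)
  have hle := upperEndpoint_le hν
  have hμtop : upperEndpoint (cdf μ) ≠ ⊤ := by
    rcases h with h | ⟨-, h⟩ | ⟨t, h, -, -⟩
    · exact h.ne_top
    · rw [h] at hle
      exact absurd hle (not_le.2 (EReal.coe_lt_top b))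
    · rw [h]
      exact EReal.coe_ne_top t
  obtain ⟨b', hb'⟩ := exists_cdf_eq_one_of_upperEndpoint_ne_top μ hμtop
  obtain ⟨τ, hτ, hτ'⟩ := exists_isLeast_cdf_eq_one μ hb'
  have hτb : (τ : EReal) ≤ b := by
    rw [← hτ']
    rcases h with h | ⟨h, -⟩ | ⟨t, h1, h2, -⟩
    · exact h.le.trans hle
    · exact absurd h hμtop
    · rw [h1, ← h2]
      exact hle
  have := monotone_cdf μ (EReal.coe_le_coe_iff.1 hτb)
  rw [show cdf μ τ = 1 from hτ.1] at this
  linarith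

/-- Either the values before the upper end point of `μ` exhaust its mass, or the end point is an
atom of `μ` that lies before the upper end point of `ν`. -/
theorem ConditionR1.exhaust_or_atom [IsProbabilityMeasure μ]
    (h : ConditionR1 (cdf μ) (cdf ν)) :
    (∀ ε > 0, ∃ b, cdf μ b < 1 ∧ 1 - ε < cdf μ b) ∨
      ∃ τ, cdf μ τ = 1 ∧ cdf ν τ < 1 ∧ μ {τ} ≠ 0 := by
  by_cases hex : ∃ b, cdf μ b = 1
  · obtain ⟨b, hb⟩ := hex
    obtain ⟨τ, hτ, hτ'⟩ := exists_isLeast_cdf_eq_one μ hb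
    have hτ1 : cdf μ τ = 1 := hτ.1
    by_cases hc : ContinuousAt (cdf μ) τ
    · refine Or.inl fun ε hε => ?_
      have h1 : ∀ᶠ t in 𝓝[<] τ, 1 - ε < cdf μ t :=
        (hc.eventually (lt_mem_nhds (by rw [hτ1]; linarith))).filter_mono nhdsWithin_le_nhds
      obtain ⟨t, h2, h3⟩ := (h1.and self_mem_nhdsWithin).exists
      refine ⟨t, lt_of_le_of_ne (cdf_le_one μ t) fun h4 => ?_, h2⟩
      exact absurd (hτ.2 h4) (not_le.2 h3)
    · refine Or.inr ⟨τ, hτ1, ?_, fun h0 => hc ((measure_singleton_eq_zero_iff μ τ).1 h0)⟩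
      by_contra hν
      have hle := upperEndpoint_le (le_antisymm (cdf_le_one ν τ) (not_lt.1 hν))
      rcases h with h | ⟨h, -⟩ | ⟨t, h1, -, h2⟩
      · rw [hτ'] at h
        exact absurd h (not_lt.2 hle)
      · rw [hτ'] at h
        exact EReal.coe_ne_top τ h
      · rw [hτ', EReal.coe_eq_coe_iff] at h1
        exact hc (h1 ▸ h2)
  · push Not at hex
    refine Or.inl fun ε hε => ?_
    obtain ⟨b, hb⟩ := ((tendsto_cdf_atTop μ).eventually
      (lt_mem_nhds (show 1 - ε < 1 by linarith))).exists
    exact ⟨b, lt_of_le_of_ne (cdf_le_one μ b) (hex b), hb⟩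

variable (μ) in
/-- Countably many points suffice to bracket every real number up to a small probability: the
rational numbers, and the atoms. -/
theorem exists_countable_bracket : ∃ Q : Set ℝ, Q.Countable ∧ ∀ a : ℝ, ∀ ε > 0,
    ∃ b ∈ Q, ∃ c ∈ Q, b ≤ a ∧ a ≤ c ∧ cdf μ c - cdf μ b ≤ ε := by
  refine ⟨Set.range ((↑) : ℚ → ℝ) ∪ {s | ¬ ContinuousAt (cdf μ) s},
    (Set.countable_range _).union (monotone_cdf μ).countable_not_continuousAt, fun a ε hε => ?_⟩
  by_cases hc : ContinuousAt (cdf μ) a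
  · obtain ⟨η, hη, h⟩ := Metric.continuousAt_iff.1 hc (ε / 2) (half_pos hε)
    obtain ⟨b, hb, hb'⟩ := exists_rat_btwn (show a - η < a by linarith)
    obtain ⟨c, hc, hc'⟩ := exists_rat_btwn (show a < a + η by linarith)
    refine ⟨b, Or.inl ⟨b, rfl⟩, c, Or.inl ⟨c, rfl⟩, hb'.le, hc.le, ?_⟩
    have h1 := h (show dist (b : ℝ) a < η by
      rw [Real.dist_eq, abs_lt]
      constructor <;> linarith)
    have h2 := h (show dist (c : ℝ) a < η by
      rw [Real.dist_eq, abs_lt]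
      constructor <;> linarith)
    rw [Real.dist_eq, abs_lt] at h1 h2
    linarith [h1.1, h2.2]
  · exact ⟨a, Or.inr hc, a, Or.inr hc, le_rfl, le_rfl, by simpa using hε.le⟩

/-- The multivariate form of `exists_countable_bracket`. The vectors all of whose coordinates
belong to countable bracketing sets for the marginals suffice. -/
theorem exists_countable_bracket_pi {p : ℕ} (ρ : Measure (Fin p → ℝ)) [IsProbabilityMeasure ρ] :
    ∃ Q : Set (Fin p → ℝ), Q.Countable ∧ ∀ v : Fin p → ℝ, ∀ ε > 0,
      ∃ b ∈ Q, ∃ c ∈ Q, b ≤ v ∧ v ≤ c ∧ ρ.real (Set.Iic c) - ρ.real (Set.Iic b) ≤ ε := by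
  have hprob : ∀ k : Fin p, IsProbabilityMeasure (ρ.map fun x => x k) := fun k =>
    Measure.isProbabilityMeasure_map (measurable_pi_apply k).aemeasurable
  choose Q hQ hbr using fun k : Fin p => exists_countable_bracket (ρ.map fun x => x k)
  refine ⟨Set.univ.pi Q, Set.countable_univ_pi hQ, fun v ε hε => ?_⟩
  have hε' : 0 < ε / ((p : ℝ) + 1) := by positivity
  choose b hb c hc hbv hvc hbc using fun k => hbr k (v k) _ hε'
  refine ⟨b, fun k _ => hb k, c, fun k _ => hc k, hbv, hvc, ?_⟩
  have hle : b ≤ c := fun k => (hbv k).trans (hvc k)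
  rw [← measureReal_sdiff (Set.Iic_subset_Iic.2 hle) measurableSet_Iic]
  have hsub : Set.Iic c \ Set.Iic b ⊆ ⋃ k ∈ (Finset.univ : Finset (Fin p)),
      (fun x : Fin p → ℝ => x k) ⁻¹' (Set.Iic (c k) \ Set.Iic (b k)) := by
    rintro x ⟨h1, h2⟩
    obtain ⟨k, hk⟩ : ∃ k, ¬ x k ≤ b k := by
      by_contra! h
      exact h2 h
    exact Set.mem_biUnion (Finset.mem_coe.2 (Finset.mem_univ k)) ⟨h1 k, hk⟩
  have hk : ∀ k, ρ.real ((fun x : Fin p → ℝ => x k) ⁻¹' (Set.Iic (c k) \ Set.Iic (b k))) ≤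
      ε / ((p : ℝ) + 1) := fun k => by
    rw [← map_measureReal_apply (measurable_pi_apply k) (measurableSet_Iic.diff measurableSet_Iic),
      measureReal_sdiff (Set.Iic_subset_Iic.2 (hle k)) measurableSet_Iic, ← cdf_eq_real,
      ← cdf_eq_real]
    exact hbc k
  refine (measureReal_mono hsub (measure_ne_top _ _)).trans
    ((measureReal_biUnion_finset_le _ _).trans ((Finset.sum_le_sum fun k _ => hk k).trans ?_))
  rw [Finset.sum_const, Finset.card_univ, Fintype.card_fin, nsmul_eq_mul, ← mul_div_assoc,
    div_le_iff₀ (by positivity)]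
  nlinarith

end Cdf

/-! ### Convergence up to the end points -/

section Atom

variable {n : ℕ} {r : ℕ → ℝ} {δ : ℕ → Prop} {τ : ℝ}

/-- If everybody at risk at `τ` dies there, the Kaplan–Meier estimator drops to zero at `τ`. -/
theorem kmProd_eq_zero (hτ : ∀ k < n, τ ≤ r k → r k = τ ∧ δ k) {k : ℕ} (hk : k < n)
    (hrk : r k = τ) {L : Set ℝ} (hL : τ ∈ L) : kmProd n r δ L = 0 := by
  classical
  have hδ : δ k := (hτ k hk hrk.ge).2
  refine Finset.prod_eq_zero (i := τ)
    (Finset.mem_filter.2 ⟨mem_deathTimes.2 ⟨k, hk, hδ, hrk⟩, hL⟩) ?_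
  have h1 : deaths n r δ τ = atRisk n r τ := by
    refine le_antisymm (deaths_le_atRisk τ) (Finset.card_le_card fun j hj => ?_)
    simp only [Finset.mem_filter, Finset.mem_range] at hj ⊢
    exact ⟨hj.1, (hτ j hj.1 hj.2).2, (hτ j hj.1 hj.2).1⟩
  have h2 : (0 : ℝ) < atRisk n r τ := by exact_mod_cast atRisk_pos hk hrk.ge
  rw [h1, div_self h2.ne', sub_self]

/-- The Kaplan–Meier estimator stays positive as long as somebody is at risk. -/
theorem kmProd_pos {k : ℕ} (hk : k < n) {L : Set ℝ} (hL : IsLowerSet L) (hrk : r k ∉ L) :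
    0 < kmProd n r δ L := by
  classical
  refine Finset.prod_pos fun s hs => ?_
  have hsk : s < r k := by
    by_contra h
    exact hrk (hL (not_lt.1 h) (Finset.mem_filter.1 hs).2)
  have hpos : (0 : ℝ) < atRisk n r s := by exact_mod_cast atRisk_pos hk hsk.le
  rw [sub_pos, div_lt_one hpos]
  refine Nat.cast_lt.2 (Finset.card_lt_card (Finset.ssubset_iff_of_subset ?_ |>.2
    ⟨k, by simp [hk, hsk.le], by simp [hsk.ne']⟩))
  intro j hj
  simp only [Finset.mem_filter] at hj ⊢
  exact ⟨hj.1, hj.2.2.ge⟩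

/-- If the largest observation is uncensored, it leaves every censored observation something to its
right, so the whole mass is redistributed. -/
theorem massBelow_eq_one (hle : ∀ k < n, r k ≤ τ) (hτ : ∀ k < n, τ ≤ r k → r k = τ ∧ δ k)
    {k : ℕ} (hk : k < n) (hrk : r k = τ) {a : ℝ} (ha : τ ≤ a) {i : ℕ} (hi : i < n) :
    massBelow n r δ a i = 1 := by
  rw [massBelow, if_pos ((hle i hi).trans ha)]
  split_ifs with hδ
  · rfl
  · have hlt : r i < τ := lt_of_not_ge fun h => hδ (hτ i hi h).2
    have hpos : 0 < kmProd n r δ (Set.Iic (r i)) :=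
      kmProd_pos hk (isLowerSet_Iic _) (by rw [hrk]; exact not_le.2 hlt)
    rw [kmProd_eq_zero hτ hk hrk (Set.mem_Iic.2 ha), kmProd_eq_zero hτ hk hrk (Set.mem_univ τ),
      sub_zero, div_self hpos.ne']

end Atom

namespace IsRandomCensorship

variable {Ω E : Type*} [MeasurableSpace Ω] [MeasurableSpace E] {P : Measure Ω}
  [IsProbabilityMeasure P]
  {T : ℕ → Ω → ℝ} {X : ℕ → Ω → E} {C : ℕ → Ω → ℝ}

variable {V : Set E}

theorem ae_le (h : IsRandomCensorship P T X C) {τ : ℝ} (hτ : P.real {ω | T 0 ω ≤ τ} = 1) :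
    ∀ᵐ ω ∂P, ∀ i, T i ω ≤ τ := by
  refine ae_all_iff.2 fun i => ?_
  have h1 : IdentDistrib (T 0) (T i) P P := ((h.identDistrib_sample i).comp measurable_fst).symm
  have hm : MeasurableSet {ω | T 0 ω ≤ τ} := h.measurable_T 0 measurableSet_Iic
  refine h1.ae_mem_snd (t := Set.Iic τ) measurableSet_Iic ?_
  refine (prob_compl_eq_zero_iff hm).2 ?_
  rw [← ENNReal.toReal_eq_one_iff]
  exact hτ

/-- An atom `τ` of the values that the censoring does not hide is eventually observed. -/
theorem ae_eventually_exists_eq (h : IsRandomCensorship P T X C) {τ : ℝ}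
    (hT : P.map (T 0) {τ} ≠ 0) (hC : 0 < P.real {ω | C 0 ω ∉ Set.Iic τ}) :
    ∀ᵐ ω ∂P, ∀ᶠ n in atTop, ∃ k < n, T k ω = τ ∧ τ ≤ C k ω := by
  have hpos : 0 < P.real {ω | (T 0 ω, X 0 ω, C 0 ω) ∈ {z : ℝ × E × ℝ | z.1 = τ ∧ τ ≤ z.2.2}} := by
    have h1 := h.real_and_censoring (A := {τ}) (B := Set.Ici τ)
      (measurableSet_singleton τ) measurableSet_Ici
    refine lt_of_lt_of_eq (mul_pos ?_ ?_) h1.symm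
    · rw [Measure.map_apply (h.measurable_T 0) (measurableSet_singleton τ)] at hT
      exact ENNReal.toReal_pos hT (measure_ne_top _ _)
    · refine hC.trans_le (measureReal_mono fun ω hω => ?_)
      exact (not_le.1 (show ¬ C 0 ω ≤ τ from hω)).le
  have hm : MeasurableSet {z : ℝ × E × ℝ | z.1 = τ ∧ τ ≤ z.2.2} :=
    MeasurableSet.inter (s₁ := {z : ℝ × E × ℝ | z.1 = τ}) (s₂ := {z | τ ≤ z.2.2})
      (measurableSet_eq_fun (by fun_prop) (by fun_prop))
      (measurableSet_le (by fun_prop) (by fun_prop))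
  filter_upwards [h.ae_tendsto_freq hm] with ω hω
  filter_upwards [hω.eventually (lt_mem_nhds hpos)] with n hn
  by_contra! hc
  rw [freq_eq_zero fun k hk h => absurd h.2 (not_le.2 (hc k hk h.1))] at hn
  exact lt_irrefl _ hn

/-- Under `ConditionR1`, the part of the mass that the Kaplan–Meier estimator fails to assign tends
to zero. -/
theorem ae_tendsto_kmProd_univ (h : IsRandomCensorship P T X C)
    (hat : ∀ s, P.map (T 0) {s} = 0 ∨ P.map (C 0) {s} = 0)
    (hR1 : ConditionR1 (cdf (P.map (T 0))) (cdf (P.map (C 0)))) :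
    ∀ᵐ ω ∂P, Tendsto (fun n => kmProd n (fun i => min (T i ω) (C i ω))
      (fun i => T i ω ≤ C i ω) Set.univ) atTop (𝓝 0) := by
  have := Measure.isProbabilityMeasure_map (μ := P) (h.measurable_T 0).aemeasurable
  rcases hR1.exhaust_or_atom with hex | ⟨τ, hτ, hDτ, hatom⟩
  · choose b hb hb' using fun N : ℕ => hex (1 / ((N : ℝ) + 1)) (by positivity)
    have h1 : ∀ᵐ ω ∂P, ∀ N, _ := ae_all_iff.2 fun N => h.ae_tendsto_kmProd hat (t := b N)
      (real_notMem_Iic_pos (h.measurable_T 0) (hb N))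
      (real_notMem_Iic_pos (h.measurable_C 0) (hR1.cdf_lt_one (hb N)))
    filter_upwards [h1] with ω h1
    refine tendsto_of_forall_sandwich fun ε hε => ?_
    obtain ⟨N, hN⟩ := exists_nat_one_div_lt hε
    refine ⟨fun _ => 0, _, 0, _, tendsto_const_nhds, h1 N,
      Eventually.of_forall fun n => kmProd_nonneg _,
      Eventually.of_forall fun n => kmProd_anti (Set.subset_univ _), by linarith, ?_⟩
    rw [real_notMem_Iic (h.measurable_T 0)]
    linarith [hb' N]
  · filter_upwards [h.ae_le ((cdf_map (h.measurable_T 0) τ).symm.trans hτ),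
      h.ae_eventually_exists_eq hatom (real_notMem_Iic_pos (h.measurable_C 0) hDτ)] with ω h1 h2
    refine tendsto_const_nhds.congr' ?_
    filter_upwards [h2] with n ⟨k, hk, hTk, hCk⟩
    refine (kmProd_eq_zero (τ := τ) (fun j _ hj => ?_) hk ?_ (Set.mem_univ τ)).symm
    · have h3 : T j ω = τ := le_antisymm (h1 j) (le_min_iff.1 hj).1
      have h4 : τ ≤ C j ω := (le_min_iff.1 hj).2
      exact ⟨by rw [h3, min_eq_left h4], h3.le.trans h4⟩
    · rw [hTk, min_eq_left hCk]

/-- Convergence of the redistributed mass at a given point. -/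
theorem ae_tendsto_massFreq (h : IsRandomCensorship P T X C)
    (hat : ∀ s, P.map (T 0) {s} = 0 ∨ P.map (C 0) {s} = 0)
    (hR1 : ConditionR1 (cdf (P.map (T 0))) (cdf (P.map (C 0)))) (hV : MeasurableSet V) (a : ℝ) :
    ∀ᵐ ω ∂P, Tendsto (fun n : ℕ => massFreq n (fun i => min (T i ω) (C i ω))
      (fun i => T i ω ≤ C i ω) a (fun i => X i ω ∈ V)) atTop
      (𝓝 (P.real {ω | T 0 ω ≤ a} * P.real {ω | X 0 ω ∈ V})) := by
  have := Measure.isProbabilityMeasure_map (μ := P) (h.measurable_T 0).aemeasurable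
  have hdef := h.ae_tendsto_kmProd_univ hat hR1
  have hlt : ∀ b, cdf (P.map (T 0)) b < 1 → _ := fun b hb =>
    h.ae_tendsto_massFreq_of_lt hat (real_notMem_Iic_pos (h.measurable_T 0) hb)
      (real_notMem_Iic_pos (h.measurable_C 0) (hR1.cdf_lt_one hb)) hdef hV
  rcases lt_or_eq_of_le (cdf_le_one (P.map (T 0)) a) with ha | ha
  · exact hlt a ha
  have hfreq : ∀ᵐ ω ∂P, Tendsto (fun n => freq n (fun i => X i ω ∈ V)) atTop
      (𝓝 (P.real {ω | X 0 ω ∈ V})) :=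
    h.ae_tendsto_freq (A := {z : ℝ × E × ℝ | z.2.1 ∈ V})
      ((by fun_prop : Measurable fun z : ℝ × E × ℝ => z.2.1) hV)
  rw [← cdf_map (h.measurable_T 0), ha, one_mul]
  rcases hR1.exhaust_or_atom with hex | ⟨τ, hτ, hDτ, hatom⟩
  · choose b hb hb' using fun N : ℕ => hex (1 / ((N : ℝ) + 1)) (by positivity)
    have h1 : ∀ᵐ ω ∂P, ∀ N, _ := ae_all_iff.2 fun N => hlt (b N) (hb N)
    filter_upwards [h1, hfreq] with ω h1 hfreq
    refine tendsto_of_forall_sandwich fun ε hε => ?_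
    obtain ⟨N, hN⟩ := exists_nat_one_div_lt hε
    have hba : b N ≤ a := by
      by_contra hc
      have := monotone_cdf (P.map (T 0)) (not_le.1 hc).le
      linarith [hb N]
    refine ⟨_, _, _, _, h1 N, hfreq, Eventually.of_forall fun n => massFreq_mono hba fun _ => id,
      Eventually.of_forall fun n => massFreq_le_freq _ _, ?_, by linarith⟩
    rw [← cdf_map (h.measurable_T 0)]
    have h3 : P.real {ω | X 0 ω ∈ V} ≤ 1 := measureReal_le_one
    have h4 : 0 ≤ P.real {ω | X 0 ω ∈ V} := measureReal_nonneg
    nlinarith [hb' N, hb N]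
  · -- below the atom `τ` the distribution function is less than one
    have hτa : τ ≤ a := by
      by_contra hc
      have h1 : Disjoint (Set.Iic a) {τ} := Set.disjoint_singleton_right.2 hc
      have h2 := measureReal_union (μ := P.map (T 0)) h1 (measurableSet_singleton τ)
      have h3 : (P.map (T 0)).real (Set.Iic a ∪ {τ}) ≤ 1 := measureReal_le_one
      have h4 : 0 < (P.map (T 0)).real {τ} := ENNReal.toReal_pos hatom (measure_ne_top _ _)
      rw [cdf_eq_real] at ha
      linarith
    filter_upwards [h.ae_le ((cdf_map (h.measurable_T 0) τ).symm.trans hτ),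
      h.ae_eventually_exists_eq hatom (real_notMem_Iic_pos (h.measurable_C 0) hDτ), hfreq]
      with ω h1 h2 hfreq
    refine hfreq.congr' ?_
    filter_upwards [h2] with n ⟨k, hk, hTk, hCk⟩
    unfold freq massFreq
    classical
    rw [Finset.sum_congr rfl fun i hi => massBelow_eq_one (τ := τ)
      (fun j _ => (min_le_left _ _).trans (h1 j)) (fun j _ hj => ?_) hk ?_ hτa
      (Finset.mem_range.1 (Finset.mem_filter.1 hi).1)]
    · simp [countBelow]
    · have h3 : T j ω = τ := le_antisymm (h1 j) (le_min_iff.1 hj).1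
      have h4 : τ ≤ C j ω := (le_min_iff.1 hj).2
      exact ⟨by rw [h3, min_eq_left h4], h3.le.trans h4⟩
    · rw [hTk, min_eq_left hCk]

end IsRandomCensorship

/-! ### The censored linear model -/

variable {Ω : Type*} [MeasurableSpace Ω] {P : Measure Ω} {p : ℕ}

/-- The errors `u`, censored by `c - β₀' x`, follow the random censorship model. -/
theorem IsCensoredLinearModel.isRandomCensorship {β₀ : Fin p → ℝ} {u : ℕ → Ω → ℝ}
    {x : ℕ → Ω → Fin p → ℝ} {c y : ℕ → Ω → ℝ} (h : IsCensoredLinearModel P β₀ u x c y) :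
    IsRandomCensorship P u x (fun i ω => c i ω - β₀ ⬝ᵥ x i ω) := by
  have hdot : Measurable fun v : Fin p → ℝ => β₀ ⬝ᵥ v := by
    unfold dotProduct
    fun_prop
  have hg : Measurable fun z : ℝ × (Fin p → ℝ) × ℝ => (z.1, z.2.1, z.2.2 - β₀ ⬝ᵥ z.2.1) := by
    fun_prop
  have hg' : Measurable fun z : (Fin p → ℝ) × ℝ => (z.1, z.2 - β₀ ⬝ᵥ z.1) := by
    fun_prop
  exact ⟨fun i => hg.comp ((h.measurable_error i).prodMk
      ((h.measurable_covariate i).prodMk (h.measurable_censoring i))),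
    h.iIndepFun_sample.comp (fun _ => _) fun _ => hg,
    fun i => (h.identDistrib_sample i).comp hg, (h.indepFun_error 0).comp measurable_id hg'⟩

/-- At the true parameter the censored residuals are the censored errors. -/
theorem IsCensoredLinearModel.Hstar_eq {β₀ : Fin p → ℝ} {u : ℕ → Ω → ℝ}
    {x : ℕ → Ω → Fin p → ℝ} {c y : ℕ → Ω → ℝ} (h : IsCensoredLinearModel P β₀ u x c y)
    (n : ℕ) (ω : Ω) (a : ℝ) (v : Fin p → ℝ) :
    Hstar x c y β₀ n ω a v = massFreq n (fun i => min (u i ω) (c i ω - β₀ ⬝ᵥ x i ω))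
      (fun i => u i ω ≤ c i ω - β₀ ⬝ᵥ x i ω) a (fun i => x i ω ∈ Set.Iic v) := by
  have hr : censoredResidual x c y β₀ ω = fun i => min (u i ω) (c i ω - β₀ ⬝ᵥ x i ω) := by
    funext i
    rw [censoredResidual, observedResponse, ← min_sub_sub_right, h.response_eq,
      add_sub_cancel_left]
  have hδ : uncensored c y ω = fun i => u i ω ≤ c i ω - β₀ ⬝ᵥ x i ω := by
    funext i
    rw [uncensored, h.response_eq, le_sub_iff_add_le']
  rw [Hstar, redistributedDistribution_eq, hr, hδ]
  rfl

end CensoredRegression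

end

theorem theorem1 {Ω : Type*} [MeasurableSpace Ω] (P : Measure Ω) [IsProbabilityMeasure P]
    {p : ℕ} (β₀ : Fin p → ℝ) (u : ℕ → Ω → ℝ) (x : ℕ → Ω → Fin p → ℝ) (c y : ℕ → Ω → ℝ)
    (hmodel : CensoredRegression.IsCensoredLinearModel P β₀ u x c y)
    (F D : ℝ → ℝ)
    (hF : F = fun t => cdf (P.map (u 0)) t)
    (hD : D = fun t => cdf (P.map (fun ω => c 0 ω - β₀ ⬝ᵥ x 0 ω)) t)
    (hR1 : CensoredRegression.ConditionR1 F D)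
    (hR2 : CensoredRegression.ConditionR2 F D) :
    ∀ᵐ ω ∂P, ∀ (a : ℝ) (v : Fin p → ℝ),
      Tendsto (fun n : ℕ => CensoredRegression.Hstar x c y β₀ n ω a v) atTop
        (𝓝 (F a * (P.map (x 0)).real (Set.Iic v))) := by
  subst hF hD
  have h := hmodel.isRandomCensorship
  have := Measure.isProbabilityMeasure_map (μ := P) (h.measurable_T 0).aemeasurable
  have := Measure.isProbabilityMeasure_map (μ := P) (h.measurable_C 0).aemeasurable
  have := Measure.isProbabilityMeasure_map (μ := P) (h.measurable_X 0).aemeasurable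
  have hat : ∀ s, P.map (u 0) {s} = 0 ∨ P.map (fun ω => c 0 ω - β₀ ⬝ᵥ x 0 ω) {s} = 0 := fun s =>
    (hR2 s).imp (CensoredRegression.measure_singleton_eq_zero_iff _ s).2
      (CensoredRegression.measure_singleton_eq_zero_iff _ s).2
  -- convergence on a countable set of points, extended to all points by monotonicity
  obtain ⟨A, hA, hbrA⟩ := CensoredRegression.exists_countable_bracket (P.map (u 0))
  obtain ⟨W, hW, hbrW⟩ := CensoredRegression.exists_countable_bracket_pi (P.map (x 0))
  have hpt : ∀ a v, ∀ᵐ ω ∂P,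
      Tendsto (fun n : ℕ => CensoredRegression.Hstar x c y β₀ n ω a v) atTop
        (𝓝 (cdf (P.map (u 0)) a * (P.map (x 0)).real (Set.Iic v))) := fun a v => by
    filter_upwards [h.ae_tendsto_massFreq hat hR1 (measurableSet_Iic (a := v)) a] with ω hω
    simp only [hmodel.Hstar_eq]
    rw [CensoredRegression.cdf_map (h.measurable_T 0),
      map_measureReal_apply (h.measurable_X 0) measurableSet_Iic]
    exact hω
  have hall : ∀ᵐ ω ∂P, ∀ a ∈ A, ∀ v ∈ W,
      Tendsto (fun n : ℕ => CensoredRegression.Hstar x c y β₀ n ω a v) atTop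
        (𝓝 (cdf (P.map (u 0)) a * (P.map (x 0)).real (Set.Iic v))) :=
    (ae_ball_iff hA).2 fun a _ => (ae_ball_iff hW).2 fun v _ => hpt a v
  filter_upwards [hall] with ω hω a v
  refine CensoredRegression.tendsto_of_forall_sandwich fun ε hε => ?_
  obtain ⟨a₁, ha₁, a₂, ha₂, haa₁, haa₂, hFa⟩ := hbrA a (ε / 2) (half_pos hε)
  obtain ⟨v₁, hv₁, v₂, hv₂, hvv₁, hvv₂, hGv⟩ := hbrW v (ε / 2) (half_pos hε)
  refine ⟨_, _, _, _, hω a₁ ha₁ v₁ hv₁, hω a₂ ha₂ v₂ hv₂, Eventually.of_forall fun n => ?_,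
    Eventually.of_forall fun n => ?_, ?_, ?_⟩
  · simp only [hmodel.Hstar_eq]
    exact CensoredRegression.massFreq_mono haa₁ fun i hi => le_trans hi hvv₁
  · simp only [hmodel.Hstar_eq]
    exact CensoredRegression.massFreq_mono haa₂ fun i hi => le_trans hi hvv₂
  all_goals
    have h1 := monotone_cdf (P.map (u 0)) haa₁
    have h2 := monotone_cdf (P.map (u 0)) haa₂
    have h3 : (P.map (x 0)).real (Set.Iic v₁) ≤ (P.map (x 0)).real (Set.Iic v) :=
      measureReal_mono (Set.Iic_subset_Iic.2 hvv₁)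
    have h4 : (P.map (x 0)).real (Set.Iic v) ≤ (P.map (x 0)).real (Set.Iic v₂) :=
      measureReal_mono (Set.Iic_subset_Iic.2 hvv₂)
    have h5 : (P.map (x 0)).real (Set.Iic v₂) ≤ 1 := measureReal_le_one
    have h6 : 0 ≤ (P.map (x 0)).real (Set.Iic v₁) := measureReal_nonneg
    have h7 := cdf_le_one (P.map (u 0)) a₂
    have h8 := cdf_nonneg (P.map (u 0)) a₁
    nlinarith
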